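/- Let $\gamma\ge 1$, $\Delta t>0$, $\varepsilon_0>0$ be fixed. Consider the one-dimensional nondimensional Euler equations $\partial_t w+\partial_x f_\varepsilon(w)=0$, $\varepsilon\in(0,\varepsilon_0]$, with periodic boundary conditions on $\Omega=[-\pi,\pi]$, where $$w=(\rho,\rho u,E)^T,\qquad f_\varepsilon(w)=\Big(\rho u,\ \rho u^2+\tfrac{p}{\varepsilon^2},\ u(E+p)\Big)^T,\qquad p=(\gamma-1)\Big(E-\tfrac{\varepsilon^2}{2}\rho u^2\Big).$$ Let $H^\infty=\{\varphi\in L^2(\Omega):\ \sum_{k\in\mathbb Z}(1+|k|^2)^q|\widehat\varphi(k)|^2<\infty\ \ \forall q\in\mathbb N\}$, its elements being identified with their continuous periodic representatives. A family $v^\varepsilon$, with components in $H^\infty$ for all sufficiently small $\varepsilon>0$, is said to have a Hilbert expansion $v_0+\varepsilon v_1+\varepsilon^2v_2+\dots$ if the coefficients $v_j$ do not depend on $\varepsilon$, have components in $H^\infty$, and for all $N,q\in\mathbb N$ the components of $v^\varepsilon-\sum_{j=0}^N\varepsilon^jv_j$ are $\mathcal O(\varepsilon^{N+1})$ in the Sobolev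 norm $\big(\sum_k(1+|k|^2)^q|\widehat{\,\cdot\,}(k)|^2\big)^{1/2}$ as $\varepsilon\to0^+$. For $\varepsilon\in(0,\varepsilon_0]$ let $w_R=w_R^\varepsilon\in\mathbb R^3$ be a reference state that is constant in space (it may be independent of $\varepsilon$; otherwise it is assumed to have a Hilbert expansion), whose density and internal energy $E_R-\frac{\varepsilon^2}{2}\rho_Ru_R^2$ are bounded below by a positive constant independent of $\varepsilon$. Let $w^n=w^{n,\varepsilon}$ and $w^{n+1}=w^{n+1,\varepsilon}$ have components in $H^\infty$, let the density of $w^n$ be bounded below by a positive constant independent of $\varepsilon$ and $x$, and let $w^{n+1}$ be obtained from $w^n$ by one step of the linearly implicit scheme $$\frac{w^{n+1}-w^n}{\Delta t}=-\partial_x\Big(f_\varepsilon(w^n)+f_\varepsilon'(w_R)\,(w^{n+1}-w^n)\Big)\quad\text{for all }\varepsilon\in(0,\varepsilon_0],$$ where $f_\varepsilon'$ is the Jacobian matrix of $f_\varepsilon$. Assume that $\delta w^n=w^n-w_R$ has a Hilbert expansion. Then $\delta w^{n+1}=w^{n+1}-w_R$ has a Hilbert expansion $$\delta w^{n+1}=\delta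 w_0^{n+1}+\varepsilon\,\delta w_1^{n+1}+\varepsilon^2\,\delta w_2^{n+1}+\dots .$$ -/

import Mathlib

open Filter Topology Asymptotics

noncomputable section

/-- Conserved variables of the one-dimensional Euler equations:
`w 0 = ρ` (density), `w 1 = ρ u` (momentum), `w 2 = E` (total energy). -/
abbrev EulerState : Type := Fin 3 → ℝ

/-- Internal energy density `E - (ε² / 2) ρ u²`, with `ε` the reference Mach number. -/
def internalEnergy (ε : ℝ) (w : EulerState) : ℝ :=
  w 2 - ε ^ 2 / 2 * ((w 1) ^ 2 / w 0)

/-- Pressure; the equation of state `E = p / (γ - 1) + (ε² / 2) ρ u²`, solved for `p`. -/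
def pressure (γ ε : ℝ) (w : EulerState) : ℝ :=
  (γ - 1) * internalEnergy ε w

/-- The nondimensional Euler flux `(ρ u, ρ u² + p / ε², u (E + p))`. -/
def eulerFlux (γ ε : ℝ) (w : EulerState) : EulerState :=
  ![w 1, (w 1) ^ 2 / w 0 + pressure γ ε w / ε ^ 2, w 1 / w 0 * (w 2 + pressure γ ε w)]

/-- One step `w0 = wⁿ ↦ w1 = wⁿ⁺¹` of the linearly implicit scheme, in strong form on the line:
`(w1 - w0) / Δt = - ∂ₓ (f(w0) + f'(wR) (w1 - w0))`, with a reference state `wR` that is constant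
in space and `f'` the Jacobian of the Euler flux. -/
def IsLinearlyImplicitStep (γ ε Δt : ℝ) (wR : EulerState) (w0 w1 : ℝ → EulerState) : Prop :=
  ∀ x : ℝ, HasDerivAt
    (fun y => eulerFlux γ ε (w0 y) + fderiv ℝ (eulerFlux γ ε) wR (w1 y - w0 y))
    (-(Δt⁻¹ • (w1 x - w0 x))) x

/-- The Fourier coefficient `(2π)⁻¹ ∫_{-π}^{π} φ(x) e^{-ikx} dx`. -/
def fourierHat (φ : ℝ → ℝ) (k : ℤ) : ℂ :=
  fourierCoeffOn (neg_lt_self Real.pi_pos) (fun x => (φ x : ℂ)) k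

/-- The norm of the Sobolev space `H^p` of the circle,
`(∑_k (1 + |k|²)^p |φ̂(k)|²)^{1/2}`; used for functions where the sum is finite. -/
def sobolevNorm (p : ℕ) (φ : ℝ → ℝ) : ℝ :=
  Real.sqrt (∑' k : ℤ, (1 + (k : ℝ) ^ 2) ^ p * ‖fourierHat φ k‖ ^ 2)

/-- The space `H^∞` of `[-π, π]` with periodic boundary conditions: all sums
`∑_k (1 + |k|²)^p |φ̂(k)|²` are finite. An element is represented by its continuous
representative, extended periodically to the line. -/
structure HInfty (φ : ℝ → ℝ) : Prop where
  continuous : Continuous φ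
  periodic : Function.Periodic φ (2 * Real.pi)
  summable : ∀ p : ℕ, Summable fun k : ℤ => (1 + (k : ℝ) ^ 2) ^ p * ‖fourierHat φ k‖ ^ 2

/-- All three components of a field of states lie in `H^∞`. -/
def StateHInfty (w : ℝ → EulerState) : Prop :=
  ∀ i : Fin 3, HInfty fun x => w x i

/-- The family `v ε` (`ε > 0` small) has a Hilbert expansion `v₀ + ε v₁ + ε² v₂ + …`: there are
coefficients in `H^∞`, independent of `ε`, such that for every order `N` the remainder is
`O(ε^{N+1})` as `ε → 0+`, in every Sobolev norm. -/
def HasHilbertExpansion (v : ℝ → ℝ → EulerState) : Prop :=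
  (∀ᶠ ε in 𝓝[>] (0 : ℝ), StateHInfty (v ε)) ∧
  ∃ a : ℕ → ℝ → EulerState, (∀ j, StateHInfty (a j)) ∧
    ∀ (N p : ℕ) (i : Fin 3),
      (fun ε : ℝ => sobolevNorm p
        (fun x => v ε x i - ∑ j ∈ Finset.range (N + 1), ε ^ j * a j x i))
      =O[𝓝[>] (0 : ℝ)] (fun ε : ℝ => ε ^ (N + 1))

end

/-!
The reference state is constant in space, so in Fourier variables the step is a `3 × 3` linear
system for each frequency `k`, with data the coefficients of `f_ε(wⁿ)`. The matrix and the data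
contain `ε⁻²`, but only in the momentum equation. Multiplied by `ε²` (when `γ > 1`), that
equation has coefficients with expansions in `ε`, and the system stays invertible: besides the
transport factor `1 + i k Δt u`, of modulus at least one, its determinant is `ε² (1 + i k Δt u)²
+ (k Δt)² (γ - 1) γ e / ρ`, where `e` is the internal energy. For `k ≠ 0` this is bounded away
from zero uniformly in small `ε` and in `k`, and for `k = 0` the increment vanishes. When `γ =
1` the pressure vanishes, the flux does not contain `ε⁻²`, and the determinant is a power of the
transport factor. This is `hasExpansion_of_linearized_step`, with
`exists_le_norm_acoustic_factor` for the lower bound.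

It remains to know that expansions survive the algebraic operations in the nonlinear flux and in
the solution of the system. Three classes of families that are bounded as `ε → 0+` are used:
smooth periodic functions with bounded derivatives (`smoothBounded`), sequences of Fourier
coefficients with rapid decay (`rapidDecay`), and Fourier symbols of polynomial growth
(`polyGrowth`). For each the notion of expansion is `HasExpansion`, built from the finite-order
`HasExpansionTo`, which is stable under products, linear operators, and inverses of families
bounded away from zero. The first two classes correspond under the Fourier transform
(`HasExpansion.fourierHat`, `HasExpansion.fourierSynth`), and the first is equivalent to a
Hilbert expansion in all Sobolev norms (`HasHilbertExpansion.hasExpansion`,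
`hasHilbertExpansion_of_hasExpansion`).
-/

noncomputable section

/-! ### Asymptotic expansions over a class of bounded families -/

section Expansion

variable {X Y 𝕜 𝕜' : Type*} [RCLike 𝕜] [RCLike 𝕜']

/-- A notion of "bounded as `ε → 0+`" for families `v : ℝ → X → 𝕜` of functions: an additive group
of families that depends only on the germ of `ε ↦ v ε` at `0+`, is stable under multiplication by
`ε`, and is bounded at every point of `X`. -/
structure IsBoundedClass (B : AddSubgroup (ℝ → X → 𝕜)) : Prop where
  congr : ∀ {v w : ℝ → X → 𝕜}, v ∈ B → v =ᶠ[𝓝[>] 0] w → w ∈ B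
  smul : ∀ {v : ℝ → X → 𝕜}, v ∈ B → (fun ε => ε • v ε) ∈ B
  pointwise : ∀ {v : ℝ → X → 𝕜}, v ∈ B → ∀ x, ∃ C : ℝ, ∀ᶠ ε in 𝓝[>] 0, ‖v ε x‖ ≤ C

/-- `v` has an expansion with `N` coefficients and a remainder of order `ε ^ N`, boundedness being
measured by `B`. The definition peels off one coefficient at a time: `v = a + ε r`, where `r` has an
expansion with one coefficient less. In this form products and inverses are handled by induction,
with no Cauchy product or recursion for the coefficients. -/
def HasExpansionTo (B : AddSubgroup (ℝ → X → 𝕜)) : ℕ → (ℝ → X → 𝕜) → Prop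
  | 0, v => v ∈ B
  | N + 1, v => ∃ a : X → 𝕜, (fun _ => a) ∈ B ∧ HasExpansionTo B N (fun ε => ε⁻¹ • (v ε - a))

/-- `v` has expansions of every finite order. By `HasExpansion.exists_coeff` these come from a
single sequence of coefficients. -/
def HasExpansion (B : AddSubgroup (ℝ → X → 𝕜)) (v : ℝ → X → 𝕜) : Prop :=
  ∀ N, HasExpansionTo B N v

theorem eventually_pos_nhdsGT_zero : ∀ᶠ ε : ℝ in 𝓝[>] 0, 0 < ε :=
  eventually_mem_nhdsWithin

variable {B : AddSubgroup (ℝ → X → 𝕜)} {v w : ℝ → X → 𝕜} {N : ℕ}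

namespace HasExpansionTo

theorem congr (hB : IsBoundedClass B) (hv : HasExpansionTo B N v) (h : v =ᶠ[𝓝[>] 0] w) :
    HasExpansionTo B N w := by
  induction N generalizing v w with
  | zero => exact hB.congr hv h
  | succ N ih =>
    obtain ⟨a, ha, hr⟩ := hv
    exact ⟨a, ha, ih hr (h.mono fun ε hε => by simp only [hε])⟩

theorem of_succ (hB : IsBoundedClass B) (hv : HasExpansionTo B (N + 1) v) :
    HasExpansionTo B N v := by
  induction N generalizing v with
  | zero =>
    obtain ⟨a, ha, hr⟩ := hv
    refine hB.congr (B.add_mem ha (hB.smul hr)) ?_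
    filter_upwards [eventually_pos_nhdsGT_zero] with ε hε
    simp [smul_smul, hε.ne']
  | succ N ih =>
    obtain ⟨a, ha, hr⟩ := hv
    exact ⟨a, ha, ih hr⟩

theorem mem (hB : IsBoundedClass B) (hv : HasExpansionTo B N v) : v ∈ B := by
  induction N with
  | zero => exact hv
  | succ N ih => exact ih (hv.of_succ hB)

theorem const {a : X → 𝕜} (ha : (fun _ => a) ∈ B) : HasExpansionTo B N (fun _ => a) := by
  induction N generalizing a with
  | zero => exact ha
  | succ N ih =>
    refine ⟨a, ha, ?_⟩
    have h0 : (fun _ : ℝ => (0 : X → 𝕜)) ∈ B := B.zero_mem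
    simpa using ih h0

theorem add (hv : HasExpansionTo B N v) (hw : HasExpansionTo B N w) :
    HasExpansionTo B N (v + w) := by
  induction N generalizing v w with
  | zero => exact B.add_mem hv hw
  | succ N ih =>
    obtain ⟨a, ha, hr⟩ := hv
    obtain ⟨b, hb, hs⟩ := hw
    refine ⟨a + b, B.add_mem ha hb, ?_⟩
    convert ih hr hs using 1
    funext ε x
    simp only [Pi.smul_apply, Pi.sub_apply, Pi.add_apply, ← smul_add]
    congr 1; ring

/-- Operators preserve expansions. Linearity of `T` is required only on differences `v ε - a` with
`v` and `a` bounded, since Fourier integrals and series are additive only on such functions. -/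
theorem map {B' : AddSubgroup (ℝ → Y → 𝕜')} (hB : IsBoundedClass B) (hB' : IsBoundedClass B')
    (T : (X → 𝕜) → Y → 𝕜') (hT : ∀ v ∈ B, (fun ε => T (v ε)) ∈ B')
    (hlin : ∀ v ∈ B, ∀ a, (fun _ => a) ∈ B → ∀ᶠ ε : ℝ in 𝓝[>] 0,
      T (ε⁻¹ • (v ε - a)) = ε⁻¹ • (T (v ε) - T a))
    (hv : HasExpansionTo B N v) : HasExpansionTo B' N (fun ε => T (v ε)) := by
  induction N generalizing v with
  | zero => exact hT v hv
  | succ N ih =>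
    have hvB := hv.mem hB
    obtain ⟨a, ha, hr⟩ := hv
    exact ⟨T a, hT _ ha, (ih hr).congr hB' (hlin v hvB a ha)⟩

theorem mul {B₁ B₂ B₃ : AddSubgroup (ℝ → X → 𝕜)} (h₂ : IsBoundedClass B₂)
    (hmul : ∀ v ∈ B₁, ∀ w ∈ B₂, v * w ∈ B₃) (hv : HasExpansionTo B₁ N v)
    (hw : HasExpansionTo B₂ N w) : HasExpansionTo B₃ N (v * w) := by
  induction N generalizing v w with
  | zero => exact hmul v hv w hw
  | succ N ih =>
    have hw' := hw.of_succ h₂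
    obtain ⟨a, ha, hr⟩ := hv
    obtain ⟨b, hb, hs⟩ := hw
    refine ⟨a * b, hmul _ ha _ hb, ?_⟩
    -- `(v w - a b) / ε = ((v - a) / ε) w + a ((w - b) / ε)`
    convert (ih hr hw').add (ih (const ha) hs) using 1
    funext ε x
    simp only [Pi.smul_apply, Pi.sub_apply, Pi.add_apply, Pi.mul_apply, smul_mul_assoc,
      mul_smul_comm, ← smul_add]
    congr 1; ring

end HasExpansionTo

/-- The leading coefficient is the pointwise limit, hence unique. -/
theorem IsBoundedClass.tendsto_of_mem (hB : IsBoundedClass B) {a : X → 𝕜}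
    (h : (fun ε : ℝ => ε⁻¹ • (v ε - a)) ∈ B) (x : X) :
    Tendsto (fun ε => v ε x) (𝓝[>] 0) (𝓝 (a x)) := by
  obtain ⟨C, hC⟩ := hB.pointwise h x
  rw [tendsto_iff_norm_sub_tendsto_zero]
  have h0 : Tendsto (fun ε : ℝ => ε * C) (𝓝[>] 0) (𝓝 0) := by
    have : Tendsto (fun ε : ℝ => ε * C) (𝓝 0) (𝓝 (0 * C)) := tendsto_id.mul_const C
    rw [zero_mul] at this
    exact this.mono_left nhdsWithin_le_nhds
  refine squeeze_zero' (Eventually.of_forall fun _ => norm_nonneg _) ?_ h0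
  filter_upwards [hC, eventually_pos_nhdsGT_zero] with ε hε hpos
  rw [Pi.smul_apply, Pi.sub_apply, norm_smul, Real.norm_of_nonneg (by positivity),
    inv_mul_le_iff₀ hpos] at hε
  exact hε

/-- Inverses of families bounded away from zero: the leading coefficient inherits the lower bound
as a pointwise limit, and `(v⁻¹ - a⁻¹) / ε = -v⁻¹ ((v - a) / ε) a⁻¹`. -/
theorem HasExpansionTo.inv (hB : IsBoundedClass B) (hmul : ∀ v ∈ B, ∀ w ∈ B, v * w ∈ B)
    (hinv : ∀ v ∈ B, ∀ c > 0, (∀ᶠ ε in 𝓝[>] (0 : ℝ), ∀ x, c ≤ ‖v ε x‖) → v⁻¹ ∈ B)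
    {c : ℝ} (hc : 0 < c) (hvc : ∀ᶠ ε in 𝓝[>] (0 : ℝ), ∀ x, c ≤ ‖v ε x‖)
    (hv : HasExpansionTo B N v) : HasExpansionTo B N v⁻¹ := by
  induction N with
  | zero => exact hinv v hv c hc hvc
  | succ N ih =>
    have hv' := ih (hv.of_succ hB)
    obtain ⟨a, ha, hr⟩ := hv
    have hac : ∀ x, c ≤ ‖a x‖ := fun x =>
      ge_of_tendsto (hB.tendsto_of_mem (hr.mem hB) x).norm (hvc.mono fun ε h => h x)
    have hai : (fun _ : ℝ => a⁻¹) ∈ B := hinv _ ha c hc (Eventually.of_forall fun _ => hac)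
    refine ⟨a⁻¹, hai, ?_⟩
    have hneg : (fun _ : ℝ => -a⁻¹) ∈ B := B.neg_mem hai
    refine ((hv'.mul hB hmul hr).mul hB hmul (const hneg)).congr hB ?_
    filter_upwards [hvc] with ε hε
    funext x
    have h1 : v ε x ≠ 0 := norm_pos_iff.1 (hc.trans_le (hε x))
    have h2 : a x ≠ 0 := norm_pos_iff.1 (hc.trans_le (hac x))
    simp only [Pi.smul_apply, Pi.sub_apply, Pi.mul_apply, Pi.inv_apply, Pi.neg_apply,
      smul_mul_assoc, mul_smul_comm]
    congr 1
    field_simp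
    ring

theorem HasExpansion.exists_coeff_zero (hB : IsBoundedClass B) (hv : HasExpansion B v) :
    ∃ a : X → 𝕜, (fun _ => a) ∈ B ∧ HasExpansion B (fun ε => ε⁻¹ • (v ε - a)) := by
  obtain ⟨a, ha, hr⟩ := hv 1
  refine ⟨a, ha, fun N => ?_⟩
  obtain ⟨b, -, hs⟩ := hv (N + 1)
  obtain rfl : a = b := funext fun x =>
    tendsto_nhds_unique (hB.tendsto_of_mem hr x) (hB.tendsto_of_mem (hs.mem hB) x)
  exact hs

/-- Uniqueness of the leading coefficient makes the expansions of all orders compatible, so that one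
sequence of coefficients serves every order. -/
theorem HasExpansion.exists_coeff (hB : IsBoundedClass B) (hv : HasExpansion B v) :
    ∃ a : ℕ → X → 𝕜, (∀ j, (fun _ => a j) ∈ B) ∧
      ∀ N, (fun ε : ℝ => (ε ^ N)⁻¹ • (v ε - ∑ j ∈ Finset.range N, ε ^ j • a j)) ∈ B := by
  choose! lead hlead hnext using fun (u : ℝ → X → 𝕜) (hu : HasExpansion B u) =>
    hu.exists_coeff_zero hB
  let u : ℕ → ℝ → X → 𝕜 := fun n => Nat.rec v (fun _ u ε => ε⁻¹ • (u ε - lead u)) n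
  have hu : ∀ n, HasExpansion B (u n) := by
    intro n
    induction n with
    | zero => exact hv
    | succ n ih => exact hnext _ ih
  refine ⟨fun n => lead (u n), fun n => hlead _ (hu n), fun N => hB.congr (hu N 0) ?_⟩
  filter_upwards [eventually_pos_nhdsGT_zero] with ε hε
  induction N with
  | zero => simp [u]
  | succ N ih =>
    have : u (N + 1) ε = ε⁻¹ • (u N ε - lead (u N)) := rfl
    rw [this, ih, Finset.sum_range_succ, ← sub_sub, smul_sub, smul_sub _ _ (ε ^ N • _),
      smul_smul, smul_smul, pow_succ, mul_inv, mul_comm (ε ^ N)⁻¹, mul_assoc,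
      inv_mul_cancel₀ (pow_ne_zero N hε.ne'), mul_one]

theorem HasExpansion.of_coeff (hB : IsBoundedClass B) (a : ℕ → X → 𝕜)
    (ha : ∀ j, (fun _ => a j) ∈ B)
    (h : ∀ N, (fun ε : ℝ => (ε ^ (N + 1))⁻¹ •
      (v ε - ∑ j ∈ Finset.range (N + 1), ε ^ j • a j)) ∈ B) :
    HasExpansion B v := by
  intro N
  induction N generalizing v a with
  | zero => exact HasExpansionTo.of_succ hB ⟨a 0, ha 0, by simpa [HasExpansionTo] using h 0⟩
  | succ N ih =>
    refine ⟨a 0, ha 0, ih (fun j => a (j + 1)) (fun j => ha _) fun M => ?_⟩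
    refine hB.congr (h (M + 1)) ?_
    filter_upwards [eventually_pos_nhdsGT_zero] with ε hε
    rw [Finset.sum_range_succ', pow_zero, one_smul, add_comm, ← sub_sub, sub_right_comm,
      add_comm 1, pow_succ _ (M + 1), mul_inv, ← smul_smul, smul_sub ε⁻¹ (v ε - a 0),
      Finset.smul_sum]
    congr 3
    funext j
    rw [smul_smul, pow_succ', inv_mul_cancel_left₀ hε.ne']

namespace HasExpansion

theorem congr (hB : IsBoundedClass B) (hv : HasExpansion B v) (h : v =ᶠ[𝓝[>] 0] w) :
    HasExpansion B w := fun N => (hv N).congr hB h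

theorem add (hv : HasExpansion B v) (hw : HasExpansion B w) : HasExpansion B (v + w) :=
  fun N => (hv N).add (hw N)

theorem map {B' : AddSubgroup (ℝ → Y → 𝕜')} (hB : IsBoundedClass B) (hB' : IsBoundedClass B')
    (T : (X → 𝕜) → Y → 𝕜') (hT : ∀ v ∈ B, (fun ε => T (v ε)) ∈ B')
    (hlin : ∀ v ∈ B, ∀ a, (fun _ => a) ∈ B → ∀ᶠ ε : ℝ in 𝓝[>] 0,
      T (ε⁻¹ • (v ε - a)) = ε⁻¹ • (T (v ε) - T a))
    (hv : HasExpansion B v) : HasExpansion B' (fun ε => T (v ε)) :=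
  fun N => (hv N).map hB hB' T hT hlin

theorem mul {B₁ B₂ B₃ : AddSubgroup (ℝ → X → 𝕜)} (h₂ : IsBoundedClass B₂)
    (hmul : ∀ v ∈ B₁, ∀ w ∈ B₂, v * w ∈ B₃) (hv : HasExpansion B₁ v)
    (hw : HasExpansion B₂ w) : HasExpansion B₃ (v * w) :=
  fun N => (hv N).mul h₂ hmul (hw N)

end HasExpansion

/-- A bounded class that is a ring and contains the inverses of those of its families that are
uniformly bounded away from zero. -/
structure IsBoundedAlgebra (B : AddSubgroup (ℝ → X → 𝕜)) : Prop extends IsBoundedClass B where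
  one_mem : 1 ∈ B
  mul_mem : ∀ v ∈ B, ∀ w ∈ B, v * w ∈ B
  inv_mem : ∀ v ∈ B, ∀ c > 0, (∀ᶠ ε in 𝓝[>] (0 : ℝ), ∀ x, c ≤ ‖v ε x‖) → v⁻¹ ∈ B

namespace IsBoundedAlgebra

/-- The families with expansions of every order form a ring. -/
def expansions (hB : IsBoundedAlgebra B) : Subring (ℝ → X → 𝕜) where
  carrier := {v | HasExpansion B v}
  mul_mem' hv hw := hv.mul hB.toIsBoundedClass hB.mul_mem hw
  one_mem' _ := HasExpansionTo.const hB.one_mem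
  add_mem' hv hw := hv.add hw
  zero_mem' _ := HasExpansionTo.const B.zero_mem
  neg_mem' {v} hv := by
    have h : HasExpansion B (-1 : ℝ → X → 𝕜) := fun _ =>
      HasExpansionTo.const (a := -1) (B.neg_mem hB.one_mem)
    have := h.mul hB.toIsBoundedClass hB.mul_mem hv
    rwa [neg_one_mul] at this

theorem const_mem_expansions (hB : IsBoundedAlgebra B) {a : X → 𝕜} (ha : (fun _ => a) ∈ B) :
    (fun _ => a) ∈ hB.expansions := fun _ => HasExpansionTo.const ha

theorem inv_mem_expansions (hB : IsBoundedAlgebra B) {c : ℝ} (hc : 0 < c)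
    (hvc : ∀ᶠ ε in 𝓝[>] (0 : ℝ), ∀ x, c ≤ ‖v ε x‖) (hv : v ∈ hB.expansions) :
    v⁻¹ ∈ hB.expansions := fun N =>
  (hv N).inv hB.toIsBoundedClass hB.mul_mem hB.inv_mem hc hvc

theorem param_mem_expansions (hB : IsBoundedAlgebra B) :
    (fun (ε : ℝ) (_ : X) => (ε : 𝕜)) ∈ hB.expansions := by
  have hmem : (fun (ε : ℝ) (_ : X) => (ε : 𝕜)) ∈ B := by
    convert hB.smul hB.one_mem using 1
    funext ε x
    simp [RCLike.real_smul_eq_coe_mul]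
  rintro (_ | N)
  · exact hmem
  · refine ⟨0, B.zero_mem, (HasExpansionTo.const (a := 1) hB.one_mem).congr
      hB.toIsBoundedClass ?_⟩
    filter_upwards [eventually_pos_nhdsGT_zero] with ε hε
    funext x
    have : (ε : 𝕜) ≠ 0 := by exact_mod_cast hε.ne'
    simp [RCLike.real_smul_eq_coe_mul, this]

end IsBoundedAlgebra

end Expansion

/-! ### Families of sequences on the dual group: symbols and Fourier coefficients -/

section Sequences

/-- Families of Fourier symbols that grow at most polynomially in the frequency, uniformly for
small `ε > 0`. -/
def polyGrowth : AddSubgroup (ℝ → ℤ → ℂ) where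
  carrier := {c | ∃ (p : ℕ) (C : ℝ), ∀ᶠ ε in 𝓝[>] (0 : ℝ), ∀ k : ℤ,
    ‖c ε k‖ ≤ C * (1 + (k : ℝ) ^ 2) ^ p}
  zero_mem' := ⟨0, 0, by simp⟩
  add_mem' := by
    rintro c d ⟨p, C, hc⟩ ⟨q, D, hd⟩
    refine ⟨p + q, |C| + |D|, ?_⟩
    filter_upwards [hc, hd] with ε h1 h2 k
    have h : (1 : ℝ) ≤ 1 + (k : ℝ) ^ 2 := by nlinarith [sq_nonneg (k : ℝ)]
    calc ‖c ε k + d ε k‖ ≤ C * (1 + (k : ℝ) ^ 2) ^ p + D * (1 + (k : ℝ) ^ 2) ^ q :=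
          (norm_add_le _ _).trans (add_le_add (h1 k) (h2 k))
      _ ≤ |C| * (1 + (k : ℝ) ^ 2) ^ (p + q) + |D| * (1 + (k : ℝ) ^ 2) ^ (p + q) := by
          gcongr
          exacts [le_abs_self C, Nat.le_add_right p q, le_abs_self D, Nat.le_add_left q p]
      _ = _ := by ring
  neg_mem' := by
    rintro c ⟨p, C, hc⟩
    exact ⟨p, C, by simpa using hc⟩

/-- Families of sequences that decay faster than any power of the frequency, uniformly for small
`ε > 0`. -/
def rapidDecay : AddSubgroup (ℝ → ℤ → ℂ) where
  carrier := {c | ∀ p : ℕ, ∃ C : ℝ, ∀ᶠ ε in 𝓝[>] (0 : ℝ), ∀ k : ℤ,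
    (1 + (k : ℝ) ^ 2) ^ p * ‖c ε k‖ ≤ C}
  zero_mem' := fun p => ⟨0, by simp⟩
  add_mem' := by
    intro c d hc hd p
    obtain ⟨C, hC⟩ := hc p
    obtain ⟨D, hD⟩ := hd p
    refine ⟨C + D, ?_⟩
    filter_upwards [hC, hD] with ε h1 h2 k
    calc (1 + (k : ℝ) ^ 2) ^ p * ‖c ε k + d ε k‖
        ≤ (1 + (k : ℝ) ^ 2) ^ p * (‖c ε k‖ + ‖d ε k‖) := by gcongr; exact norm_add_le _ _
      _ ≤ C + D := by rw [mul_add]; exact add_le_add (h1 k) (h2 k)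
  neg_mem' := by
    intro c hc p
    obtain ⟨C, hC⟩ := hc p
    exact ⟨C, by simpa using hC⟩

theorem eventually_le_one_nhdsGT_zero : ∀ᶠ ε : ℝ in 𝓝[>] 0, ε ≤ 1 :=
  nhdsWithin_le_nhds (eventually_le_nhds one_pos)

theorem norm_smul_le_of_le_one {ε : ℝ} (h0 : 0 < ε) (h1 : ε ≤ 1) {E : Type*}
    [SeminormedAddCommGroup E] [NormedSpace ℝ E] (z : E) : ‖ε • z‖ ≤ ‖z‖ := by
  rw [norm_smul, Real.norm_of_nonneg h0.le]
  exact mul_le_of_le_one_left (norm_nonneg z) h1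

theorem isBoundedAlgebra_polyGrowth : IsBoundedAlgebra polyGrowth where
  congr := by
    rintro c d ⟨p, C, hc⟩ h
    refine ⟨p, C, ?_⟩
    filter_upwards [hc, h] with ε h1 h2
    rwa [← h2]
  smul := by
    rintro c ⟨p, C, hc⟩
    refine ⟨p, C, ?_⟩
    filter_upwards [hc, eventually_pos_nhdsGT_zero, eventually_le_one_nhdsGT_zero] with ε h h0 h1 k
    exact (norm_smul_le_of_le_one h0 h1 (c ε k)).trans (h k)
  pointwise := by
    rintro c ⟨p, C, hc⟩ k
    exact ⟨_, hc.mono fun ε h => h k⟩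
  one_mem := ⟨0, 1, by simp⟩
  mul_mem := by
    rintro c ⟨p, C, hc⟩ d ⟨q, D, hd⟩
    refine ⟨p + q, C * D, ?_⟩
    filter_upwards [hc, hd] with ε h1 h2 k
    calc ‖c ε k * d ε k‖ ≤ (C * (1 + (k : ℝ) ^ 2) ^ p) * (D * (1 + (k : ℝ) ^ 2) ^ q) := by
          rw [norm_mul]
          exact mul_le_mul (h1 k) (h2 k) (norm_nonneg _) ((norm_nonneg _).trans (h1 k))
      _ = _ := by ring
  inv_mem := by
    intro c _ r hr h
    refine ⟨0, r⁻¹, h.mono fun ε hε k => ?_⟩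
    rw [pow_zero, mul_one, Pi.inv_apply, Pi.inv_apply, norm_inv]
    exact inv_anti₀ hr (hε k)

theorem isBoundedClass_rapidDecay : IsBoundedClass rapidDecay where
  congr := by
    intro c d hc h p
    obtain ⟨C, hC⟩ := hc p
    refine ⟨C, ?_⟩
    filter_upwards [hC, h] with ε h1 h2
    rwa [← h2]
  smul := by
    intro c hc p
    obtain ⟨C, hC⟩ := hc p
    refine ⟨C, ?_⟩
    filter_upwards [hC, eventually_pos_nhdsGT_zero, eventually_le_one_nhdsGT_zero] with ε h h0 h1 k
    exact (mul_le_mul_of_nonneg_left (norm_smul_le_of_le_one h0 h1 (c ε k))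
      (by positivity)).trans (h k)
  pointwise := by
    intro c hc k
    obtain ⟨C, hC⟩ := hc 0
    exact ⟨C, hC.mono fun ε h => by simpa using h k⟩

theorem polyGrowth_mul_rapidDecay {c d : ℝ → ℤ → ℂ} (hc : c ∈ polyGrowth) (hd : d ∈ rapidDecay) :
    c * d ∈ rapidDecay := by
  obtain ⟨q, C, hC⟩ := hc
  intro p
  obtain ⟨D, hD⟩ := hd (p + q)
  refine ⟨|C| * D, ?_⟩
  filter_upwards [hC, hD] with ε h1 h2 k
  calc (1 + (k : ℝ) ^ 2) ^ p * ‖c ε k * d ε k‖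
      ≤ (1 + (k : ℝ) ^ 2) ^ p * ((|C| * (1 + (k : ℝ) ^ 2) ^ q) * ‖d ε k‖) := by
        rw [norm_mul]
        gcongr
        exact (h1 k).trans (by gcongr; exact le_abs_self C)
    _ = |C| * ((1 + (k : ℝ) ^ 2) ^ (p + q) * ‖d ε k‖) := by ring
    _ ≤ |C| * D := by gcongr; exact h2 k

theorem summable_inv_one_add_sq : Summable fun k : ℤ => (1 + (k : ℝ) ^ 2)⁻¹ := by
  refine Summable.of_nonneg_of_le (fun k => by positivity) (fun k => ?_)
    ((Real.summable_one_div_int_pow.2 one_lt_two).add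
      (hasSum_ite_eq (0 : ℤ) (1 : ℝ)).summable)
  rcases eq_or_ne k 0 with rfl | hk
  · simp
  · have : (0 : ℝ) < (k : ℝ) ^ 2 := by positivity
    rw [if_neg hk, add_zero, one_div]
    exact inv_anti₀ this (by linarith)

theorem norm_le_of_one_add_sq_mul_norm_le {c : ℂ} {C : ℝ} {k : ℤ}
    (h : (1 + (k : ℝ) ^ 2) ^ 1 * ‖c‖ ≤ C) : ‖c‖ ≤ C * (1 + (k : ℝ) ^ 2)⁻¹ := by
  rw [pow_one] at h
  rw [← div_eq_mul_inv, le_div_iff₀ (by positivity)]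
  linarith

end Sequences

/-! ### Families of smooth periodic functions -/

section Smooth

/-- For small `ε > 0` the functions `v ε` are `q` times differentiable, and the derivatives of order
at most `q` are bounded uniformly in `ε` and `x`. The recursion on `deriv` reduces products and
inverses to the product and quotient rules of first order. -/
def HasBoundedDerivs : ℕ → (ℝ → ℝ → ℝ) → Prop
  | 0, v => ∃ C : ℝ, ∀ᶠ ε in 𝓝[>] (0 : ℝ), ∀ x, ‖v ε x‖ ≤ C
  | q + 1, v => (∃ C : ℝ, ∀ᶠ ε in 𝓝[>] (0 : ℝ), ∀ x, ‖v ε x‖ ≤ C) ∧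
      (∀ᶠ ε in 𝓝[>] (0 : ℝ), Differentiable ℝ (v ε)) ∧ HasBoundedDerivs q fun ε => deriv (v ε)

variable {v w : ℝ → ℝ → ℝ} {q : ℕ}

namespace HasBoundedDerivs

theorem bounded (h : HasBoundedDerivs q v) :
    ∃ C : ℝ, ∀ᶠ ε in 𝓝[>] (0 : ℝ), ∀ x, ‖v ε x‖ ≤ C := by
  cases q with
  | zero => exact h
  | succ q => exact h.1

theorem of_succ (h : HasBoundedDerivs (q + 1) v) : HasBoundedDerivs q v := by
  induction q generalizing v with
  | zero => exact h.bounded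
  | succ q ih => exact ⟨h.1, h.2.1, ih h.2.2⟩

theorem congr (hv : HasBoundedDerivs q v) (h : v =ᶠ[𝓝[>] 0] w) : HasBoundedDerivs q w := by
  induction q generalizing v w with
  | zero =>
    obtain ⟨C, hC⟩ := hv.bounded
    refine ⟨C, ?_⟩
    filter_upwards [hC, h] with ε h1 h2
    rwa [← h2]
  | succ q ih =>
    refine ⟨(ih hv.of_succ h).bounded, ?_, ih hv.2.2 (h.mono fun ε hε => by simp only [hε])⟩
    filter_upwards [hv.2.1, h] with ε h1 h2
    rwa [← h2]

theorem const (q : ℕ) (r : ℝ) : HasBoundedDerivs q fun _ _ => r := by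
  induction q generalizing r with
  | zero => exact ⟨‖r‖, by simp⟩
  | succ q ih =>
    refine ⟨⟨‖r‖, by simp⟩, Eventually.of_forall fun _ => differentiable_const _, ?_⟩
    simpa using ih 0

theorem bounded_add (hv : HasBoundedDerivs q v) (hw : HasBoundedDerivs q w) :
    ∃ C : ℝ, ∀ᶠ ε in 𝓝[>] (0 : ℝ), ∀ x, ‖v ε x + w ε x‖ ≤ C := by
  obtain ⟨C, hC⟩ := hv.bounded
  obtain ⟨D, hD⟩ := hw.bounded
  refine ⟨C + D, ?_⟩
  filter_upwards [hC, hD] with ε h1 h2 x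
  exact (norm_add_le _ _).trans (add_le_add (h1 x) (h2 x))

theorem bounded_mul (hv : HasBoundedDerivs q v) (hw : HasBoundedDerivs q w) :
    ∃ C : ℝ, ∀ᶠ ε in 𝓝[>] (0 : ℝ), ∀ x, ‖v ε x * w ε x‖ ≤ C := by
  obtain ⟨C, hC⟩ := hv.bounded
  obtain ⟨D, hD⟩ := hw.bounded
  refine ⟨C * D, ?_⟩
  filter_upwards [hC, hD] with ε h1 h2 x
  rw [norm_mul]
  exact mul_le_mul (h1 x) (h2 x) (norm_nonneg _) ((norm_nonneg _).trans (h1 x))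

theorem add (hv : HasBoundedDerivs q v) (hw : HasBoundedDerivs q w) :
    HasBoundedDerivs q (v + w) := by
  induction q generalizing v w with
  | zero => exact bounded_add hv hw
  | succ q ih =>
    refine ⟨bounded_add hv hw, ?_, (ih hv.2.2 hw.2.2).congr ?_⟩
    · filter_upwards [hv.2.1, hw.2.1] with ε h1 h2 using h1.add h2
    · filter_upwards [hv.2.1, hw.2.1] with ε h1 h2
      funext x
      exact (deriv_add (h1 x) (h2 x)).symm

theorem mul (hv : HasBoundedDerivs q v) (hw : HasBoundedDerivs q w) :
    HasBoundedDerivs q (v * w) := by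
  induction q generalizing v w with
  | zero => exact bounded_mul hv hw
  | succ q ih =>
    refine ⟨bounded_mul hv hw, ?_, ((ih hv.2.2 hw.of_succ).add (ih hv.of_succ hw.2.2)).congr ?_⟩
    · filter_upwards [hv.2.1, hw.2.1] with ε h1 h2 using h1.mul h2
    · filter_upwards [hv.2.1, hw.2.1] with ε h1 h2
      funext x
      exact (deriv_mul (h1 x) (h2 x)).symm

theorem inv (hv : HasBoundedDerivs q v) {c : ℝ} (hc : 0 < c)
    (h : ∀ᶠ ε in 𝓝[>] (0 : ℝ), ∀ x, c ≤ ‖v ε x‖) : HasBoundedDerivs q v⁻¹ := by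
  have hb : ∃ C : ℝ, ∀ᶠ ε in 𝓝[>] (0 : ℝ), ∀ x, ‖(v ε x)⁻¹‖ ≤ C :=
    ⟨c⁻¹, h.mono fun ε hε x => by rw [norm_inv]; exact inv_anti₀ hc (hε x)⟩
  induction q with
  | zero => exact hb
  | succ q ih =>
    have hi := ih hv.of_succ
    have hne : ∀ᶠ ε in 𝓝[>] (0 : ℝ), ∀ x, v ε x ≠ 0 :=
      h.mono fun ε hε x => norm_pos_iff.1 (hc.trans_le (hε x))
    refine ⟨hb, ?_, ((const q (-1)).mul (hv.2.2.mul (hi.mul hi))).congr ?_⟩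
    · filter_upwards [hv.2.1, hne] with ε h1 h2 using h1.inv h2
    · filter_upwards [hv.2.1, hne] with ε h1 h2
      funext x
      have := ((h1 x).hasDerivAt.inv (h2 x)).deriv
      simp only [Pi.mul_apply, Pi.inv_apply]
      refine Eq.trans ?_ this.symm
      have := h2 x
      field_simp

end HasBoundedDerivs

/-- Families of smooth `2π`-periodic functions with every derivative bounded uniformly for small
`ε > 0`. -/
def smoothBounded : AddSubgroup (ℝ → ℝ → ℝ) where
  carrier := {v | (∀ q, HasBoundedDerivs q v) ∧
    ∀ᶠ ε in 𝓝[>] (0 : ℝ), Function.Periodic (v ε) (2 * Real.pi)}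
  zero_mem' := ⟨fun q => HasBoundedDerivs.const q 0, Eventually.of_forall fun _ _ => rfl⟩
  add_mem' := by
    rintro v w ⟨hv, hv'⟩ ⟨hw, hw'⟩
    refine ⟨fun q => (hv q).add (hw q), ?_⟩
    filter_upwards [hv', hw'] with ε h1 h2 using h1.add h2
  neg_mem' := by
    rintro v ⟨hv, hv'⟩
    refine ⟨fun q => ?_, hv'.mono fun ε h x => congrArg Neg.neg (h x)⟩
    convert (HasBoundedDerivs.const q (-1)).mul (hv q) using 1
    funext ε x
    simp

theorem isBoundedAlgebra_smoothBounded : IsBoundedAlgebra smoothBounded where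
  congr := by
    rintro v w ⟨hv, hv'⟩ h
    refine ⟨fun q => (hv q).congr h, ?_⟩
    filter_upwards [hv', h] with ε h1 h2
    rwa [← h2]
  smul := by
    rintro v ⟨hv, hv'⟩
    have hε : ∀ q, HasBoundedDerivs q fun ε _ => ε := by
      have hb : ∃ C : ℝ, ∀ᶠ ε in 𝓝[>] (0 : ℝ), ∀ _ : ℝ, ‖ε‖ ≤ C := by
        refine ⟨1, ?_⟩
        filter_upwards [eventually_pos_nhdsGT_zero, eventually_le_one_nhdsGT_zero] with ε h0 h1 x
        rwa [Real.norm_of_nonneg h0.le]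
      rintro (_ | q)
      · exact hb
      · exact ⟨hb, Eventually.of_forall fun _ => differentiable_const _,
          by simpa using HasBoundedDerivs.const q 0⟩
    refine ⟨fun q => (hε q).mul (hv q), hv'.mono fun ε h x => congrArg (ε • ·) (h x)⟩
  pointwise := by
    rintro v ⟨hv, -⟩ x
    obtain ⟨C, hC⟩ := hv 0
    exact ⟨C, hC.mono fun ε h => h x⟩
  one_mem := ⟨fun q => HasBoundedDerivs.const q 1, Eventually.of_forall fun _ _ => rfl⟩
  mul_mem := by
    rintro v ⟨hv, hv'⟩ w ⟨hw, hw'⟩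
    refine ⟨fun q => (hv q).mul (hw q), ?_⟩
    filter_upwards [hv', hw'] with ε h1 h2 using h1.mul h2
  inv_mem := by
    rintro v ⟨hv, hv'⟩ c hc h
    exact ⟨fun q => (hv q).inv hc h, hv'.mono fun ε h x => congrArg Inv.inv (h x)⟩

theorem eventually_differentiable_of_mem (hv : v ∈ smoothBounded) :
    ∀ᶠ ε in 𝓝[>] (0 : ℝ), Differentiable ℝ (v ε) := (hv.1 1).2.1

theorem deriv_mem_smoothBounded (hv : v ∈ smoothBounded) :
    (fun ε => deriv (v ε)) ∈ smoothBounded := by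
  refine ⟨fun q => (hv.1 (q + 1)).2.2, ?_⟩
  filter_upwards [hv.2] with ε h x
  rw [← deriv_comp_add_const]
  congr 1
  funext y
  exact h y

end Smooth

/-! ### Fourier coefficients and Fourier synthesis -/

section Fourier

theorem fourier_two_pi_apply (k : ℤ) (x : ℝ) :
    fourier k (x : AddCircle (Real.pi - -Real.pi)) = Complex.exp (Complex.I * k * x) := by
  rw [fourier_coe_apply]
  congr 1
  have : (Real.pi : ℂ) ≠ 0 := by exact_mod_cast Real.pi_ne_zero
  push_cast
  field_simp
  ring

theorem fourierHat_eq_integral (φ : ℝ → ℝ) (k : ℤ) :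
    fourierHat φ k = (2 * Real.pi : ℝ)⁻¹ •
      ∫ x in -Real.pi..Real.pi, Complex.exp (-(Complex.I * k * x)) * (φ x : ℂ) := by
  rw [fourierHat, fourierCoeffOn_eq_integral]
  congr 1
  · rw [one_div]; congr 1; ring
  · congr 1
    funext x
    rw [fourier_two_pi_apply, smul_eq_mul]
    congr 2
    push_cast
    ring

theorem norm_exp_I_mul_int_mul (k : ℤ) (x : ℝ) : ‖Complex.exp (Complex.I * k * x)‖ = 1 := by
  have : Complex.I * k * x = ((k * x : ℝ) : ℂ) * Complex.I := by push_cast; ring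
  rw [this, Complex.norm_exp_ofReal_mul_I]

theorem norm_fourierHat_le {φ : ℝ → ℝ} {C : ℝ} (h : ∀ x, ‖φ x‖ ≤ C) (k : ℤ) :
    ‖fourierHat φ k‖ ≤ C := by
  have hpi := Real.pi_pos
  rw [fourierHat_eq_integral, norm_smul, norm_inv, Real.norm_of_nonneg (by positivity),
    inv_mul_le_iff₀ (by positivity)]
  refine (intervalIntegral.norm_integral_le_of_norm_le_const (C := C) fun x _ => ?_).trans ?_
  · have := norm_exp_I_mul_int_mul (-k) x
    rw [norm_mul, show -(Complex.I * k * x) = Complex.I * ((-k : ℤ) : ℂ) * x by push_cast; ring,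
      this, one_mul, Complex.norm_real]
    exact h x
  · rw [abs_of_pos (by linarith)]
    linarith

theorem fourierHat_smul (r : ℝ) (φ : ℝ → ℝ) : fourierHat (r • φ) = r • fourierHat φ := by
  funext k
  rw [Pi.smul_apply, Complex.real_smul, fourierHat, fourierHat, ← fourierCoeffOn.const_mul]
  simp

theorem fourierHat_add {φ ψ : ℝ → ℝ} (hφ : Continuous φ) (hψ : Continuous ψ) :
    fourierHat (φ + ψ) = fourierHat φ + fourierHat ψ := by
  funext k
  simp only [fourierHat_eq_integral, Pi.add_apply, Complex.ofReal_add, mul_add]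
  rw [intervalIntegral.integral_add, smul_add]
  all_goals exact Continuous.intervalIntegrable (by fun_prop) _ _

theorem fourierHat_sub {φ ψ : ℝ → ℝ} (hφ : Continuous φ) (hψ : Continuous ψ) :
    fourierHat (φ - ψ) = fourierHat φ - fourierHat ψ := by
  have : φ - ψ = φ + (-1 : ℝ) • ψ := by funext x; simp [sub_eq_add_neg]
  rw [this, fourierHat_add hφ (hψ.const_smul _), fourierHat_smul]
  funext k
  simp [sub_eq_add_neg]

/-- Integration by parts; periodicity removes the boundary terms. -/
theorem fourierHat_of_hasDerivAt {φ φ' : ℝ → ℝ} (h : ∀ x, HasDerivAt φ (φ' x) x)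
    (hφ' : Continuous φ') (hper : Function.Periodic φ (2 * Real.pi)) (k : ℤ) :
    fourierHat φ' k = Complex.I * k * fourierHat φ k := by
  have hpp : φ Real.pi = φ (-Real.pi) := by
    rw [← hper (-Real.pi)]; congr 1; ring
  have hpi : (Real.pi : ℂ) ≠ 0 := by exact_mod_cast Real.pi_ne_zero
  have hc : Continuous fun x => (φ' x : ℂ) := Complex.continuous_ofReal.comp hφ'
  have hd : ∀ x ∈ Set.uIcc (-Real.pi) Real.pi,
      HasDerivAt (fun x => (φ x : ℂ)) (φ' x : ℂ) x := fun x _ => (h x).ofReal_comp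
  rcases eq_or_ne k 0 with rfl | hk
  · rw [fourierHat_eq_integral]
    have := intervalIntegral.integral_eq_sub_of_hasDerivAt hd (hc.intervalIntegrable _ _)
    simp [this, hpp]
  · have hk' : (k : ℂ) ≠ 0 := by exact_mod_cast hk
    have := fourierCoeffOn_of_hasDerivAt (neg_lt_self Real.pi_pos) hk hd
      (hc.intervalIntegrable _ _)
    rw [fourierHat, fourierHat, this, hpp]
    push_cast
    have hI := Complex.I_ne_zero
    field_simp
    ring

/-- The real part of the trigonometric series with coefficients `c`. Taking the real part returns
to real functions without tracking the conjugation symmetry of the coefficients. -/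
def fourierSynth (c : ℤ → ℂ) (x : ℝ) : ℝ := (∑' k : ℤ, c k * Complex.exp (Complex.I * k * x)).re

theorem norm_mul_exp (c : ℂ) (k : ℤ) (x : ℝ) :
    ‖c * Complex.exp (Complex.I * k * x)‖ = ‖c‖ := by
  rw [norm_mul, norm_exp_I_mul_int_mul, mul_one]

theorem summable_mul_exp {c : ℤ → ℂ} (hc : Summable fun k => ‖c k‖) (x : ℝ) :
    Summable fun k : ℤ => c k * Complex.exp (Complex.I * k * x) :=
  Summable.of_norm (by simpa only [norm_mul_exp] using hc)

theorem fourierSynth_sub {c d : ℤ → ℂ} (hc : Summable fun k => ‖c k‖)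
    (hd : Summable fun k => ‖d k‖) :
    fourierSynth (c - d) = fourierSynth c - fourierSynth d := by
  funext x
  simp only [fourierSynth, Pi.sub_apply, sub_mul]
  rw [(summable_mul_exp hc x).tsum_sub (summable_mul_exp hd x), Complex.sub_re]

theorem fourierSynth_smul (r : ℝ) (c : ℤ → ℂ) :
    fourierSynth (r • c) = r • fourierSynth c := by
  funext x
  simp only [fourierSynth, Pi.smul_apply, Complex.real_smul, mul_assoc, tsum_mul_left,
    Complex.re_ofReal_mul, smul_eq_mul]

theorem abs_fourierSynth_le {c : ℤ → ℂ} (hc : Summable fun k => ‖c k‖) (x : ℝ) :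
    ‖fourierSynth c x‖ ≤ ∑' k, ‖c k‖ := by
  refine (Complex.abs_re_le_norm _).trans ((norm_tsum_le_tsum_norm ?_).trans_eq ?_)
  · simpa only [norm_mul_exp] using hc
  · simp only [norm_mul_exp]

theorem periodic_fourierSynth (c : ℤ → ℂ) : Function.Periodic (fourierSynth c) (2 * Real.pi) := by
  intro x
  have (k : ℤ) : Complex.exp (Complex.I * k * ((x + 2 * Real.pi : ℝ) : ℂ)) =
      Complex.exp (Complex.I * k * x) := by
    rw [show Complex.I * k * ((x + 2 * Real.pi : ℝ) : ℂ) =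
      Complex.I * k * x + k * (2 * Real.pi * Complex.I) by push_cast; ring, Complex.exp_add,
      Complex.exp_int_mul_two_pi_mul_I, mul_one]
  simp only [fourierSynth, this]

theorem hasDerivAt_fourierSynth {c : ℤ → ℂ} (hc : Summable fun k => ‖c k‖)
    (hkc : Summable fun k : ℤ => ‖Complex.I * k * c k‖) (x : ℝ) :
    HasDerivAt (fourierSynth c) (fourierSynth (fun k => Complex.I * k * c k) x) x := by
  have key : HasDerivAt (fun x : ℝ => ∑' k : ℤ, c k * Complex.exp (Complex.I * k * x))
      (∑' k : ℤ, Complex.I * k * c k * Complex.exp (Complex.I * k * x)) x := by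
    refine hasDerivAt_tsum hkc (fun k y => ?_) (fun k y => (norm_mul_exp _ k y).le)
      (summable_mul_exp hc 0) x
    have h := (((hasDerivAt_id y).ofReal_comp.const_mul (Complex.I * k)).cexp).const_mul (c k)
    exact h.congr_deriv (by simp only [id, Complex.ofReal_one]; ring)
  exact Complex.reCLM.hasFDerivAt.comp_hasDerivAt x key

theorem fourierSynth_fourierHat {φ : ℝ → ℝ} (hφ : Continuous φ)
    (hper : Function.Periodic φ (2 * Real.pi)) (hs : Summable fun k => ‖fourierHat φ k‖) :
    fourierSynth (fourierHat φ) = φ := by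
  have hT : Real.pi - -Real.pi = 2 * Real.pi := by ring
  have : Fact (0 < Real.pi - -Real.pi) := ⟨by rw [hT]; exact Real.two_pi_pos⟩
  have hper' : Function.Periodic (fun x => (φ x : ℂ)) (Real.pi - -Real.pi) := by
    rw [hT]; exact fun x => congrArg _ (hper x)
  let F : C(AddCircle (Real.pi - -Real.pi), ℂ) :=
    ⟨hper'.lift, continuous_coinduced_dom.2 (Complex.continuous_ofReal.comp hφ)⟩
  have hF : ∀ x : ℝ, F x = φ x := fun x => rfl
  have hcoef : fourierCoeff F = fourierHat φ := by
    funext k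
    rw [fourierCoeff_eq_intervalIntegral _ _ (-Real.pi), fourierHat, fourierCoeffOn_eq_integral,
      add_sub_cancel]
    rfl
  funext x
  have h := has_pointwise_sum_fourier_series_of_summable (f := F)
    (by rw [hcoef]; exact hs.of_norm) (x : AddCircle (Real.pi - -Real.pi))
  rw [hcoef] at h
  simp only [fourier_two_pi_apply, smul_eq_mul, hF] at h
  rw [fourierSynth, h.tsum_eq, Complex.ofReal_re]

end Fourier

/-! ### Expansions in physical space and in frequency space -/

section Transfer

theorem eventually_summable_of_mem_rapidDecay {c : ℝ → ℤ → ℂ} (hc : c ∈ rapidDecay) :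
    ∀ᶠ ε in 𝓝[>] (0 : ℝ), Summable fun k => ‖c ε k‖ := by
  obtain ⟨C, hC⟩ := hc 1
  filter_upwards [hC] with ε h
  exact Summable.of_nonneg_of_le (fun _ => norm_nonneg _)
    (fun k => norm_le_of_one_add_sq_mul_norm_le (h k)) (summable_inv_one_add_sq.mul_left C)

theorem int_mul_mem_rapidDecay {c : ℝ → ℤ → ℂ} (hc : c ∈ rapidDecay) :
    (fun ε k => Complex.I * k * c ε k) ∈ rapidDecay := by
  have h : (fun (_ : ℝ) (k : ℤ) => Complex.I * (k : ℂ)) ∈ polyGrowth := by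
    refine ⟨1, 1, Eventually.of_forall fun ε k => ?_⟩
    rw [norm_mul, Complex.norm_I, one_mul, one_mul, pow_one, Complex.norm_intCast]
    nlinarith [sq_abs (k : ℝ), sq_nonneg (|(k : ℝ)| - 1)]
  exact polyGrowth_mul_rapidDecay h hc

/-- Differentiation of the series multiplies the coefficients by `i k`, which preserves rapid
decay. -/
theorem fourierSynth_mem_smoothBounded {c : ℝ → ℤ → ℂ} (hc : c ∈ rapidDecay) :
    (fun ε => fourierSynth (c ε)) ∈ smoothBounded := by
  refine ⟨fun q => ?_, Eventually.of_forall fun ε => periodic_fourierSynth _⟩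
  have hb : ∀ {c : ℝ → ℤ → ℂ}, c ∈ rapidDecay →
      ∃ C : ℝ, ∀ᶠ ε in 𝓝[>] (0 : ℝ), ∀ x, ‖fourierSynth (c ε) x‖ ≤ C := by
    intro c hc
    obtain ⟨C, hC⟩ := hc 1
    refine ⟨∑' k : ℤ, C * (1 + (k : ℝ) ^ 2)⁻¹, ?_⟩
    filter_upwards [hC, eventually_summable_of_mem_rapidDecay hc] with ε h hs x
    exact (abs_fourierSynth_le hs x).trans (hs.tsum_le_tsum
      (fun k => norm_le_of_one_add_sq_mul_norm_le (h k)) (summable_inv_one_add_sq.mul_left C))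
  induction q generalizing c with
  | zero => exact hb hc
  | succ q ih =>
    have hd : ∀ᶠ ε in 𝓝[>] (0 : ℝ), ∀ x, HasDerivAt (fourierSynth (c ε))
        (fourierSynth (fun k => Complex.I * k * c ε k) x) x := by
      filter_upwards [eventually_summable_of_mem_rapidDecay hc,
        eventually_summable_of_mem_rapidDecay (int_mul_mem_rapidDecay hc)] with ε h1 h2 x
      exact hasDerivAt_fourierSynth h1 h2 x
    refine ⟨hb hc, hd.mono fun ε h x => (h x).differentiableAt,
      (ih (int_mul_mem_rapidDecay hc)).congr (hd.mono fun ε h => ?_)⟩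
    funext x
    exact (h x).deriv.symm

/-- Each application of `1 - ∂ₓ²` to the function multiplies its Fourier coefficients by
`1 + k²`. -/
theorem fourierHat_mem_rapidDecay {v : ℝ → ℝ → ℝ} (hv : v ∈ smoothBounded) :
    (fun ε => fourierHat (v ε)) ∈ rapidDecay := by
  intro p
  induction p generalizing v with
  | zero =>
    obtain ⟨C, hC⟩ := hv.1 0
    exact ⟨C, hC.mono fun ε h k => by simpa using norm_fourierHat_le h k⟩
  | succ p ih =>
    have hv1 := deriv_mem_smoothBounded hv
    have hv2 := deriv_mem_smoothBounded hv1
    obtain ⟨C, hC⟩ := ih (smoothBounded.sub_mem hv hv2)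
    refine ⟨C, ?_⟩
    filter_upwards [hC, eventually_differentiable_of_mem hv, eventually_differentiable_of_mem hv1,
      eventually_differentiable_of_mem hv2, hv.2, hv1.2] with ε h d0 d1 d2 p0 p1 k
    have e1 := fourierHat_of_hasDerivAt (fun x => (d0 x).hasDerivAt) d1.continuous p0 k
    have e2 := fourierHat_of_hasDerivAt (fun x => (d1 x).hasDerivAt) d2.continuous p1 k
    have e : fourierHat (v ε - deriv (deriv (v ε))) k =
        ((1 + (k : ℝ) ^ 2 : ℝ) : ℂ) * fourierHat (v ε) k := by
      rw [fourierHat_sub d0.continuous d2.continuous, Pi.sub_apply, e2, e1]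
      push_cast
      linear_combination (-(k : ℂ) ^ 2 * fourierHat (v ε) k) * Complex.I_sq
    have h' := h k
    simp only [Pi.sub_apply] at h'
    rw [e, norm_mul, Complex.norm_real, Real.norm_of_nonneg (by positivity), ← mul_assoc,
      ← pow_succ] at h'
    exact h'

theorem HasExpansion.fourierHat {v : ℝ → ℝ → ℝ} (hv : HasExpansion smoothBounded v) :
    HasExpansion rapidDecay (fun ε => fourierHat (v ε)) := by
  refine hv.map isBoundedAlgebra_smoothBounded.toIsBoundedClass isBoundedClass_rapidDecay
    _root_.fourierHat (fun v h => fourierHat_mem_rapidDecay h) fun v h a ha => ?_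
  filter_upwards [eventually_differentiable_of_mem h, eventually_differentiable_of_mem ha]
    with ε d1 d2
  rw [fourierHat_smul, fourierHat_sub d1.continuous d2.continuous]

theorem HasExpansion.fourierSynth {c : ℝ → ℤ → ℂ} (hc : HasExpansion rapidDecay c) :
    HasExpansion smoothBounded (fun ε => fourierSynth (c ε)) := by
  refine hc.map isBoundedClass_rapidDecay isBoundedAlgebra_smoothBounded.toIsBoundedClass
    _root_.fourierSynth (fun v h => fourierSynth_mem_smoothBounded h) fun v h a ha => ?_
  filter_upwards [eventually_summable_of_mem_rapidDecay h, eventually_summable_of_mem_rapidDecay ha]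
    with ε d1 d2
  rw [fourierSynth_smul, fourierSynth_sub d1 d2]

/-- Evaluation at the origin turns an expansion of functions constant in space into one of symbols
constant in frequency. -/
theorem HasExpansion.eval_zero {v : ℝ → ℝ → ℝ} (hv : HasExpansion smoothBounded v) :
    HasExpansion polyGrowth (fun ε _ => (v ε 0 : ℂ)) := by
  refine hv.map isBoundedAlgebra_smoothBounded.toIsBoundedClass
    isBoundedAlgebra_polyGrowth.toIsBoundedClass (fun φ _ => (φ 0 : ℂ)) (fun v h => ?_)
    fun v h a ha => Eventually.of_forall fun ε => ?_
  · obtain ⟨C, hC⟩ := h.1 0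
    exact ⟨0, C, hC.mono fun ε h k => by simpa using h 0⟩
  · funext k
    simp

end Transfer

/-! ### Hilbert expansions in Sobolev norms -/

section Sobolev

theorem HInfty.one_add_sq_pow_mul_norm_le {φ : ℝ → ℝ} (h : HInfty φ) (p : ℕ) (k : ℤ) :
    (1 + (k : ℝ) ^ 2) ^ p * ‖fourierHat φ k‖ ≤ sobolevNorm (2 * p) φ := by
  refine Real.le_sqrt_of_sq_le ?_
  have := (h.summable (2 * p)).le_tsum k fun j _ => by positivity
  rwa [mul_pow, ← pow_mul, mul_comm p 2]

theorem one_add_sq_pow_mul_norm_sq_le {c : ℂ} {k : ℤ} {p : ℕ} {C₀ C : ℝ}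
    (h₀ : (1 + (k : ℝ) ^ 2) ^ 0 * ‖c‖ ≤ C₀) (h : (1 + (k : ℝ) ^ 2) ^ (p + 1) * ‖c‖ ≤ C) :
    (1 + (k : ℝ) ^ 2) ^ p * ‖c‖ ^ 2 ≤ C * C₀ * (1 + (k : ℝ) ^ 2)⁻¹ := by
  rw [pow_zero, one_mul] at h₀
  rw [← div_eq_mul_inv, le_div_iff₀ (by positivity)]
  calc (1 + (k : ℝ) ^ 2) ^ p * ‖c‖ ^ 2 * (1 + (k : ℝ) ^ 2)
      = ((1 + (k : ℝ) ^ 2) ^ (p + 1) * ‖c‖) * ‖c‖ := by ring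
    _ ≤ C * C₀ := mul_le_mul h h₀ (norm_nonneg _) (le_trans (by positivity) h)

theorem summable_and_sobolevNorm_le {φ : ℝ → ℝ} {p : ℕ} {C₀ C : ℝ}
    (h₀ : ∀ k : ℤ, (1 + (k : ℝ) ^ 2) ^ 0 * ‖fourierHat φ k‖ ≤ C₀)
    (h : ∀ k : ℤ, (1 + (k : ℝ) ^ 2) ^ (p + 1) * ‖fourierHat φ k‖ ≤ C) :
    (Summable fun k : ℤ => (1 + (k : ℝ) ^ 2) ^ p * ‖fourierHat φ k‖ ^ 2) ∧
      sobolevNorm p φ ≤ Real.sqrt (∑' k : ℤ, C * C₀ * (1 + (k : ℝ) ^ 2)⁻¹) := by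
  have hs := summable_inv_one_add_sq.mul_left (C * C₀)
  have hle := fun k => one_add_sq_pow_mul_norm_sq_le (h₀ k) (h k)
  have hs' := Summable.of_nonneg_of_le (fun k => by positivity) hle hs
  exact ⟨hs', Real.sqrt_le_sqrt (hs'.tsum_le_tsum hle hs)⟩

/-- `H^∞` consists of the continuous periodic functions with rapidly decaying coefficients. -/
theorem hInfty_iff {φ : ℝ → ℝ} : HInfty φ ↔ Continuous φ ∧ Function.Periodic φ (2 * Real.pi) ∧
    (fun _ : ℝ => fourierHat φ) ∈ rapidDecay := by
  refine ⟨fun h => ⟨h.continuous, h.periodic, fun p => ⟨_, Eventually.of_forall fun _ =>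
    h.one_add_sq_pow_mul_norm_le p⟩⟩, fun ⟨hc, hp, hr⟩ => ⟨hc, hp, fun p => ?_⟩⟩
  obtain ⟨C₀, h₀⟩ := hr 0
  obtain ⟨C, h⟩ := hr (p + 1)
  obtain ⟨_, h₀⟩ := h₀.exists
  obtain ⟨_, h⟩ := h.exists
  exact (summable_and_sobolevNorm_le h₀ h).1

theorem hInfty_of_const_mem_smoothBounded {φ : ℝ → ℝ} (h : (fun _ => φ) ∈ smoothBounded) :
    HInfty φ := by
  obtain ⟨_, hd⟩ := (eventually_differentiable_of_mem h).exists
  obtain ⟨_, hp⟩ := h.2.exists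
  exact hInfty_iff.2 ⟨hd.continuous, hp, fourierHat_mem_rapidDecay h⟩

theorem HInfty.const_smul {φ : ℝ → ℝ} (h : HInfty φ) (r : ℝ) : HInfty (r • φ) := by
  obtain ⟨hc, hp, hr⟩ := hInfty_iff.1 h
  refine hInfty_iff.2 ⟨hc.const_smul r, fun x => congrArg (r • ·) (hp x), ?_⟩
  have : (fun (_ : ℝ) (_ : ℤ) => (r : ℂ)) ∈ polyGrowth := ⟨0, ‖r‖, by simp⟩
  convert polyGrowth_mul_rapidDecay this hr using 1
  funext ε k
  simp [fourierHat_smul]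

theorem HInfty.add {φ ψ : ℝ → ℝ} (hφ : HInfty φ) (hψ : HInfty ψ) : HInfty (φ + ψ) := by
  obtain ⟨hc, hp, hr⟩ := hInfty_iff.1 hφ
  obtain ⟨hc', hp', hr'⟩ := hInfty_iff.1 hψ
  refine hInfty_iff.2 ⟨hc.add hc', hp.add hp', ?_⟩
  rw [fourierHat_add hc hc']
  exact rapidDecay.add_mem hr hr'

theorem HInfty.sub {φ ψ : ℝ → ℝ} (hφ : HInfty φ) (hψ : HInfty ψ) : HInfty (φ - ψ) := by
  convert hφ.add (hψ.const_smul (-1)) using 1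
  funext x
  simp [sub_eq_add_neg]

theorem hInfty_zero : HInfty (0 : ℝ → ℝ) :=
  hInfty_of_const_mem_smoothBounded smoothBounded.zero_mem

theorem HInfty.sum {a : ℕ → ℝ → ℝ} (h : ∀ j, HInfty (a j)) (s : Finset ℕ) :
    HInfty (∑ j ∈ s, a j) :=
  Finset.sum_induction _ HInfty (fun _ _ => HInfty.add) hInfty_zero fun j _ => h j

theorem fourierHat_zero : fourierHat 0 = 0 := by
  simpa using fourierHat_smul 0 0

theorem fourierHat_sum {a : ℕ → ℝ → ℝ} (h : ∀ j, HInfty (a j)) (s : Finset ℕ) :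
    fourierHat (∑ j ∈ s, a j) = ∑ j ∈ s, fourierHat (a j) := by
  classical
  induction s using Finset.induction_on with
  | empty => simpa using fourierHat_zero
  | insert j s hj ih =>
    rw [Finset.sum_insert hj, Finset.sum_insert hj,
      fourierHat_add (h j).continuous (HInfty.sum h s).continuous, ih]

theorem sobolevNorm_smul (p : ℕ) (r : ℝ) (φ : ℝ → ℝ) :
    sobolevNorm p (r • φ) = ‖r‖ * sobolevNorm p φ := by
  have : ∀ k : ℤ, (1 + (k : ℝ) ^ 2) ^ p * ‖fourierHat (r • φ) k‖ ^ 2 =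
      ‖r‖ ^ 2 * ((1 + (k : ℝ) ^ 2) ^ p * ‖fourierHat φ k‖ ^ 2) := by
    intro k
    rw [fourierHat_smul, Pi.smul_apply, norm_smul]
    ring
  simp only [sobolevNorm, this, tsum_mul_left]
  rw [Real.sqrt_mul (by positivity), Real.sqrt_sq (norm_nonneg r)]

theorem exists_eventually_sobolevNorm_le {r : ℝ → ℝ → ℝ} (h : r ∈ smoothBounded) (p : ℕ) :
    ∃ C : ℝ, ∀ᶠ ε in 𝓝[>] (0 : ℝ), sobolevNorm p (r ε) ≤ C := by
  obtain ⟨C₀, h₀⟩ := fourierHat_mem_rapidDecay h 0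
  obtain ⟨C, hC⟩ := fourierHat_mem_rapidDecay h (p + 1)
  refine ⟨Real.sqrt (∑' k : ℤ, C * C₀ * (1 + (k : ℝ) ^ 2)⁻¹), ?_⟩
  filter_upwards [h₀, hC] with ε h1 h2
  exact (summable_and_sobolevNorm_le h1 h2).2

/-- Remainders that are small in every Sobolev norm have small rapidly decaying coefficients;
Fourier synthesis turns these into smooth functions with small derivatives. -/
theorem HasHilbertExpansion.hasExpansion {v : ℝ → ℝ → EulerState} (h : HasHilbertExpansion v)
    (i : Fin 3) : HasExpansion smoothBounded (fun ε x => v ε x i) := by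
  obtain ⟨hv, a, ha, hr⟩ := h
  have hd : HasExpansion rapidDecay (fun ε => fourierHat fun x => v ε x i) := by
    refine HasExpansion.of_coeff isBoundedClass_rapidDecay (fun j => fourierHat fun x => a j x i)
      (fun j => (hInfty_iff.1 (ha j i)).2.2) fun N p => ?_
    obtain ⟨C, hC⟩ := (hr N (2 * p) i).bound
    refine ⟨C, ?_⟩
    filter_upwards [hC, hv, eventually_pos_nhdsGT_zero] with ε hε hvε hpos k
    have hterm : ∀ j, HInfty (ε ^ j • fun x => a j x i) := fun j => (ha j i).const_smul _
    have hsum := HInfty.sum hterm (Finset.range (N + 1))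
    have hrem := (hvε i).sub hsum
    have hle := hrem.one_add_sq_pow_mul_norm_le p k
    rw [fourierHat_sub (hvε i).continuous hsum.continuous, fourierHat_sum hterm] at hle
    simp only [fourierHat_smul] at hle
    have e : ((fun x => v ε x i) - ∑ j ∈ Finset.range (N + 1), ε ^ j • fun x => a j x i) =
        fun x => v ε x i - ∑ j ∈ Finset.range (N + 1), ε ^ j * a j x i := by
      funext x
      simp
    rw [e] at hle
    have hpos' : 0 < ε ^ (N + 1) := pow_pos hpos _
    rw [Real.norm_of_nonneg hpos'.le] at hε
    rw [Pi.smul_apply, norm_smul, norm_inv, Real.norm_of_nonneg hpos'.le, mul_left_comm,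
      inv_mul_le_iff₀ hpos', mul_comm _ C]
    exact hle.trans ((le_abs_self _).trans hε)
  refine hd.fourierSynth.congr isBoundedAlgebra_smoothBounded.toIsBoundedClass ?_
  filter_upwards [hv, eventually_summable_of_mem_rapidDecay (hd 0)] with ε h1 h2
  exact fourierSynth_fourierHat (h1 i).continuous (h1 i).periodic h2

theorem hasHilbertExpansion_of_hasExpansion {v : ℝ → ℝ → EulerState}
    (hv : ∀ᶠ ε in 𝓝[>] (0 : ℝ), StateHInfty (v ε))
    (h : ∀ i, HasExpansion smoothBounded (fun ε x => v ε x i)) : HasHilbertExpansion v := by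
  choose a ha hr using fun i =>
    (h i).exists_coeff isBoundedAlgebra_smoothBounded.toIsBoundedClass
  refine ⟨hv, fun j x i => a i j x, fun j i => hInfty_of_const_mem_smoothBounded (ha i j),
    fun N p i => ?_⟩
  obtain ⟨C, hC⟩ := exists_eventually_sobolevNorm_le (hr i (N + 1)) p
  refine IsBigO.of_bound C ?_
  filter_upwards [hC, eventually_pos_nhdsGT_zero] with ε hε hpos
  have hpos' : 0 < ε ^ (N + 1) := pow_pos hpos _
  have e : (fun x => v ε x i - ∑ j ∈ Finset.range (N + 1), ε ^ j * a i j x) = ε ^ (N + 1) •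
      ((ε ^ (N + 1))⁻¹ • ((fun x => v ε x i) - ∑ j ∈ Finset.range (N + 1), ε ^ j • a i j)) := by
    rw [smul_inv_smul₀ hpos'.ne']
    funext x
    simp
  rw [e, sobolevNorm_smul, norm_mul, norm_norm, mul_comm C, sobolevNorm,
    Real.norm_of_nonneg (Real.sqrt_nonneg _)]
  exact mul_le_mul_of_nonneg_left hε (norm_nonneg _)

end Sobolev

/-! ### The Jacobian of the Euler flux -/

section Jacobian

theorem differentiableAt_eulerFlux (γ ε : ℝ) {w : EulerState} (hw : w 0 ≠ 0) :
    DifferentiableAt ℝ (eulerFlux γ ε) w := by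
  rw [differentiableAt_pi]
  intro i
  fin_cases i <;> simp [eulerFlux, pressure, internalEnergy] <;> fun_prop (disch := assumption)

/-- The Jacobian of the flux applied to `v`. The combination `2 u v₁ - u² v₀` is the perturbation
of `ρ u²`, and the factor `v₂ - (ε² / 2) (2 u v₁ - u² v₀)` that of the internal energy. -/
theorem fderiv_eulerFlux_apply (γ ε : ℝ) {w : EulerState} (hw : w 0 ≠ 0) (v : EulerState) :
    fderiv ℝ (eulerFlux γ ε) w v =
      ![v 1,
        2 * (w 1 / w 0) * v 1 - (w 1 / w 0) ^ 2 * v 0 + (γ - 1) / ε ^ 2 *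
          (v 2 - ε ^ 2 / 2 * (2 * (w 1 / w 0) * v 1 - (w 1 / w 0) ^ 2 * v 0)),
        (w 2 + pressure γ ε w) / w 0 * (v 1 - w 1 / w 0 * v 0) + w 1 / w 0 * (v 2 + (γ - 1) *
          (v 2 - ε ^ 2 / 2 * (2 * (w 1 / w 0) * v 1 - (w 1 / w 0) ^ 2 * v 0)))] := by
  -- Each component is differentiated along the line through `w` in direction `v`.
  have hj : ∀ j, HasDerivAt (fun t : ℝ => w j + t * v j) (v j) 0 := fun j => by
    simpa using ((hasDerivAt_id (0 : ℝ)).mul_const (v j)).const_add (w j)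
  have hline : HasDerivAt (fun t : ℝ => w + t • v) v 0 := hasDerivAt_pi.2 hj
  have hc := hasDerivAt_pi.1 ((differentiableAt_eulerFlux γ ε hw).hasFDerivAt.comp_hasDerivAt_of_eq
    0 hline (by simp))
  have h0 : w 0 + 0 * v 0 ≠ 0 := by simpa using hw
  have hq := ((hj 1).pow 2).div (hj 0) h0
  have he := (hj 2).sub (hq.const_mul (ε ^ 2 / 2))
  have hp := he.const_mul (γ - 1)
  funext i
  fin_cases i
  · exact (hc 0).unique (hj 1)
  · refine (hc 1).unique ((hq.add (hp.div_const (ε ^ 2))).congr_deriv ?_)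
    simp
    field_simp
  · refine (hc 2).unique ((((hj 1).div (hj 0) h0).mul ((hj 2).add hp)).congr_deriv ?_)
    simp [pressure, internalEnergy]
    field_simp

end Jacobian

/-! ### The scheme in frequency space -/

section Scheme

variable {γ ε Δt : ℝ} {wR : EulerState} {w0 w1 : ℝ → EulerState}

/-- The scheme decouples into a `3 × 3` system for each frequency, because the reference state is
constant in space. -/
theorem IsLinearlyImplicitStep.fourierHat_eq (hΔt : Δt ≠ 0) (hw0 : StateHInfty w0)
    (hw1 : StateHInfty w1) (hpos : ∀ x, w0 x 0 ≠ 0)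
    (hstep : IsLinearlyImplicitStep γ ε Δt wR w0 w1) (i : Fin 3) (k : ℤ) :
    fourierHat (fun x => w1 x i - w0 x i) k + Complex.I * k * Δt *
      (fourierHat (fun x => eulerFlux γ ε (w0 x) i) k +
        ∑ j, (fderiv ℝ (eulerFlux γ ε) wR (Pi.single j 1) i : ℂ) *
          fourierHat (fun x => w1 x j - w0 x j) k) = 0 := by
  have hd : ∀ j, HInfty fun x => w1 x j - w0 x j := fun j => (hw1 j).sub (hw0 j)
  have hF : Continuous fun x => eulerFlux γ ε (w0 x) i := by
    have hc : Continuous w0 := continuous_pi fun j => (hw0 j).continuous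
    exact continuous_iff_continuousAt.2 fun x => (continuous_apply i).continuousAt.comp
      ((differentiableAt_eulerFlux γ ε (hpos x)).continuousAt.comp hc.continuousAt)
  have hlin : (fun x => eulerFlux γ ε (w0 x) i + fderiv ℝ (eulerFlux γ ε) wR (w1 x - w0 x) i) =
      (fun x => eulerFlux γ ε (w0 x) i) + ((fderiv ℝ (eulerFlux γ ε) wR (Pi.single 0 1) i •
        (fun x => w1 x 0 - w0 x 0) + fderiv ℝ (eulerFlux γ ε) wR (Pi.single 1 1) i •
        (fun x => w1 x 1 - w0 x 1)) + fderiv ℝ (eulerFlux γ ε) wR (Pi.single 2 1) i •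
        (fun x => w1 x 2 - w0 x 2)) := by
    funext x
    have hv : ∀ v : EulerState, v =
        v 0 • Pi.single 0 1 + v 1 • Pi.single 1 1 + v 2 • Pi.single 2 1 := fun v => by
      funext j; fin_cases j <;> simp
    rw [hv (w1 x - w0 x)]
    simp only [map_add, map_smul, Pi.add_apply, Pi.smul_apply, Pi.sub_apply, smul_eq_mul]
    ring
  have hper : Function.Periodic
      (fun x => eulerFlux γ ε (w0 x) i + fderiv ℝ (eulerFlux γ ε) wR (w1 x - w0 x) i)
      (2 * Real.pi) := by
    intro x
    have h0 : w0 (x + 2 * Real.pi) = w0 x := funext fun j => (hw0 j).periodic x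
    have h1 : w1 (x + 2 * Real.pi) = w1 x := funext fun j => (hw1 j).periodic x
    simp only [h0, h1]
  have key := fourierHat_of_hasDerivAt (fun x => hasDerivAt_pi.1 (hstep x) i)
    (((hd i).continuous.const_smul Δt⁻¹).neg) hper k
  have hneg : (fun x => (-(Δt⁻¹ • (w1 x - w0 x))) i) = (-Δt⁻¹) • fun x => w1 x i - w0 x i := by
    funext x
    simp
  change fourierHat (fun x => (-(Δt⁻¹ • (w1 x - w0 x))) i) k = _ * fourierHat (fun x =>
    eulerFlux γ ε (w0 x) i + fderiv ℝ (eulerFlux γ ε) wR (w1 x - w0 x) i) k at key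
  have hc := fun (j : Fin 3) (r : ℝ) => (hd j).continuous.const_smul r
  rw [hneg, hlin, fourierHat_smul, fourierHat_add hF (((hc _ _).add (hc _ _)).add (hc _ _)),
    fourierHat_add ((hc _ _).add (hc _ _)) (hc _ _), fourierHat_add (hc _ _) (hc _ _),
    fourierHat_smul, fourierHat_smul, fourierHat_smul] at key
  simp only [Pi.add_apply, Pi.smul_apply, Complex.real_smul] at key
  rw [Fin.sum_univ_three]
  have hΔt' : (Δt : ℂ) ≠ 0 := by exact_mod_cast hΔt
  push_cast at key
  linear_combination (-(Δt : ℂ)) * key -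
    fourierHat (fun x => w1 x i - w0 x i) k * mul_inv_cancel₀ hΔt'

end Scheme

/-! ### Solving the linearized step mode by mode -/

section Solve

/-- Fourier symbols with expansions in `ε`. -/
def symbols : Subring (ℝ → ℤ → ℂ) := isBoundedAlgebra_polyGrowth.expansions

theorem HasExpansion.mul_of_mem_symbols {c d : ℝ → ℤ → ℂ} (hc : c ∈ symbols)
    (hd : HasExpansion rapidDecay d) : HasExpansion rapidDecay (c * d) :=
  HasExpansion.mul isBoundedClass_rapidDecay (fun _ h _ h' => polyGrowth_mul_rapidDecay h h') hc hd

theorem HasExpansion.sub_rapidDecay {c d : ℝ → ℤ → ℂ} (hc : HasExpansion rapidDecay c)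
    (hd : HasExpansion rapidDecay d) : HasExpansion rapidDecay (c - d) := by
  convert hc.add (.mul_of_mem_symbols (neg_mem (one_mem symbols)) hd) using 1
  rw [neg_one_mul, sub_eq_add_neg]

/-- The symbol `i k Δt` of `Δt ∂ₓ`. -/
def derivSymbol (Δt : ℝ) : ℝ → ℤ → ℂ := fun _ k => Complex.I * k * Δt

theorem derivSymbol_mem_symbols (Δt : ℝ) : derivSymbol Δt ∈ symbols := by
  refine isBoundedAlgebra_polyGrowth.const_mem_expansions ⟨1, |Δt|, Eventually.of_forall
    fun ε k => ?_⟩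
  rw [norm_mul, norm_mul, Complex.norm_I, one_mul, pow_one, Complex.norm_intCast,
    Complex.norm_real, Real.norm_eq_abs, mul_comm]
  gcongr
  nlinarith [sq_abs (k : ℝ), sq_nonneg (|(k : ℝ)| - 1)]

/-- A scalar depending on `ε`, as a symbol that is constant in frequency. -/
def scalarSymbol (r : ℝ → ℝ) : ℝ → ℤ → ℂ := fun ε _ => (r ε : ℂ)

theorem one_le_norm_one_add_derivSymbol_mul (Δt : ℝ) (u : ℝ → ℝ) (ε : ℝ) (k : ℤ) :
    1 ≤ ‖1 + derivSymbol Δt ε k * scalarSymbol u ε k‖ := by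
  refine le_trans (le_of_eq ?_) (Complex.abs_re_le_norm _)
  simp [derivSymbol, scalarSymbol]

/-- The indicator of the nonzero frequencies. -/
def nonzeroMode : ℝ → ℤ → ℂ := fun _ k => if k = 0 then 0 else 1

theorem nonzeroMode_mem_symbols : nonzeroMode ∈ symbols := by
  refine isBoundedAlgebra_polyGrowth.const_mem_expansions ⟨0, 1, Eventually.of_forall
    fun ε k => ?_⟩
  rcases eq_or_ne k 0 with rfl | hk
  · simp
  · simp [hk]

/-- The solution of the linearized system inherits expansions from the data.

The momentum equation enters multiplied by `α`, a power of `ε` chosen so that its coefficients have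
expansions; `β = α g / ε²` is then the weight of the pressure, and `τ = ε² / α`. With `s = i k Δt`,
`y = d₁ - u d₀` and `π` the perturbation of the internal energy, the unknowns `(y, π)` satisfy
`α (1 + s u) y + s β π = …` and `s η y + (1 + s u) π = …`, with determinant
`α (1 + s u)² - s² β η`. For `s ≠ 0` this is bounded away from zero by assumption, and the zero mode
does not change. Then `d₀` and `π` follow on division by `1 + s u`, whose modulus is at least one as
`s` is imaginary. -/
theorem hasExpansion_of_linearized_step {Δt : ℝ} {α β τ g u η : ℝ → ℝ} {H d : Fin 3 → ℝ → ℤ → ℂ}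
    (hα : scalarSymbol α ∈ symbols) (hβ : scalarSymbol β ∈ symbols)
    (hτ : scalarSymbol τ ∈ symbols) (hu : scalarSymbol u ∈ symbols)
    (hη : scalarSymbol η ∈ symbols)
    (hτα : ∀ ε, τ ε * α ε = ε ^ 2) (hτβ : ∀ ε, τ ε * β ε = g ε)
    (hα0 : ∀ᶠ ε in 𝓝[>] (0 : ℝ), α ε ≠ 0)
    (hdet : ∃ c > 0, ∀ᶠ ε in 𝓝[>] (0 : ℝ), ∀ k : ℤ, k ≠ 0 →
      c ≤ ‖(α ε : ℂ) * (1 + Complex.I * k * Δt * u ε) ^ 2 -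
        (Complex.I * k * Δt) ^ 2 * β ε * η ε‖)
    (hH : ∀ i, HasExpansion rapidDecay (H i))
    (h0 : ∀ᶠ ε in 𝓝[>] (0 : ℝ), ∀ k : ℤ,
      d 0 ε k + Complex.I * k * Δt * (H 0 ε k + d 1 ε k) = 0)
    (h1 : ∀ᶠ ε in 𝓝[>] (0 : ℝ), ∀ k : ℤ,
      α ε * d 1 ε k + Complex.I * k * Δt * (H 1 ε k +
        (α ε * (2 * u ε * d 1 ε k - u ε ^ 2 * d 0 ε k) + β ε * (d 2 ε k -
          ε ^ 2 / 2 * (2 * u ε * d 1 ε k - u ε ^ 2 * d 0 ε k)))) = 0)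
    (h2 : ∀ᶠ ε in 𝓝[>] (0 : ℝ), ∀ k : ℤ,
      d 2 ε k + Complex.I * k * Δt * (H 2 ε k +
        ((η ε + ε ^ 2 / 2 * u ε ^ 2) * (d 1 ε k - u ε * d 0 ε k) + u ε * (d 2 ε k + g ε *
          (d 2 ε k - ε ^ 2 / 2 * (2 * u ε * d 1 ε k - u ε ^ 2 * d 0 ε k))))) = 0)
    (i : Fin 3) : HasExpansion rapidDecay (d i) := by
  have hcl := isBoundedClass_rapidDecay
  have hsm := derivSymbol_mem_symbols Δt
  set s := derivSymbol Δt with hs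
  have hχ := nonzeroMode_mem_symbols
  have hε : scalarSymbol (fun ε => ε) ∈ symbols :=
    isBoundedAlgebra_polyGrowth.param_mem_expansions
  have hhalf : (fun _ _ => 2⁻¹ : ℝ → ℤ → ℂ) ∈ symbols :=
    isBoundedAlgebra_polyGrowth.const_mem_expansions ⟨0, 1, Eventually.of_forall
      fun ε k => by norm_num⟩
  obtain ⟨c, hc, hdet⟩ := hdet
  let A : ℝ → ℤ → ℂ := 1 + s * scalarSymbol u
  have hA : A ∈ symbols := add_mem (one_mem _) (mul_mem hsm hu)
  have hA1 : ∀ ε k, 1 ≤ ‖A ε k‖ := fun ε k => one_le_norm_one_add_derivSymbol_mul Δt u ε k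
  have hA0 : ∀ ε k, A ε k ≠ 0 := fun ε k => norm_pos_iff.1 (one_pos.trans_le (hA1 ε k))
  have hAinv : A⁻¹ ∈ symbols := isBoundedAlgebra_polyGrowth.inv_mem_expansions one_pos
    (Eventually.of_forall hA1) hA
  -- At `k = 0` the determinant is `α`, which may tend to zero. It is replaced by `1`, as `y = 0`
  -- for this mode.
  let D : ℝ → ℤ → ℂ := scalarSymbol α * A ^ 2 - s ^ 2 * scalarSymbol β * scalarSymbol η
  let D' : ℝ → ℤ → ℂ := nonzeroMode * D + (1 - nonzeroMode)
  have hD' : D' ∈ symbols := add_mem (mul_mem hχ (sub_mem (mul_mem hα (pow_mem hA 2))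
    (mul_mem (mul_mem (pow_mem hsm 2) hβ) hη))) (sub_mem (one_mem _) hχ)
  have hD'le : ∀ᶠ ε in 𝓝[>] (0 : ℝ), ∀ k, min c 1 ≤ ‖D' ε k‖ := by
    filter_upwards [hdet] with ε h k
    rcases eq_or_ne k 0 with rfl | hk
    · simp [D', nonzeroMode]
    · refine (min_le_left _ _).trans ((h k hk).trans_eq ?_)
      simp [D', D, A, nonzeroMode, hk, s, derivSymbol, scalarSymbol]
  have hmin : 0 < min c 1 := lt_min hc one_pos
  have hD'inv : D'⁻¹ ∈ symbols := isBoundedAlgebra_polyGrowth.inv_mem_expansions hmin hD'le hD'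
  let G : Fin 3 → ℝ → ℤ → ℂ := fun i => s * H i
  have hG : ∀ i, HasExpansion rapidDecay (G i) := fun i => (hH i).mul_of_mem_symbols hsm
  -- Energy equation minus `τ u` times momentum equation plus `ε² u² / 2` times mass equation.
  have hπ : ∀ᶠ ε in 𝓝[>] (0 : ℝ), ∀ k, A ε k * (d 2 ε k -
      ε ^ 2 / 2 * (2 * u ε * d 1 ε k - u ε ^ 2 * d 0 ε k)) +
      s ε k * η ε * (d 1 ε k - u ε * d 0 ε k) + (G 2 ε k - τ ε * u ε * G 1 ε k +
        2⁻¹ * ε ^ 2 * u ε ^ 2 * G 0 ε k) = 0 := by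
    filter_upwards [h0, h1, h2] with ε e0 e1 e2 k
    have hτα' : (τ ε : ℂ) * α ε = ε ^ 2 := by exact_mod_cast hτα ε
    have hτβ' : (τ ε : ℂ) * β ε = g ε := by exact_mod_cast hτβ ε
    simp only [A, G, s, derivSymbol, scalarSymbol, Pi.add_apply, Pi.mul_apply, Pi.one_apply]
    linear_combination e2 k - τ ε * u ε * e1 k + 2⁻¹ * ε ^ 2 * u ε ^ 2 * e0 k +
      (u ε * (d 1 ε k + Complex.I * k * Δt * (2 * u ε * d 1 ε k - u ε ^ 2 * d 0 ε k))) * hτα' +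
      (u ε * (Complex.I * k * Δt) * (d 2 ε k -
        ε ^ 2 / 2 * (2 * u ε * d 1 ε k - u ε ^ 2 * d 0 ε k))) * hτβ'
  -- Cramer's rule for `y = d 1 - u d 0`.
  let Y : ℝ → ℤ → ℂ := D'⁻¹ * (nonzeroMode * (
    s * scalarSymbol β * (G 2 - scalarSymbol τ * scalarSymbol u * G 1 +
      (fun _ _ => 2⁻¹) * scalarSymbol (fun ε => ε) ^ 2 * scalarSymbol u ^ 2 * G 0) -
      A * (G 1 - scalarSymbol α * scalarSymbol u * G 0)))
  have hY : HasExpansion rapidDecay Y := by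
    refine .mul_of_mem_symbols hD'inv (.mul_of_mem_symbols hχ (.sub_rapidDecay
      (.mul_of_mem_symbols (mul_mem hsm hβ) (.add (.sub_rapidDecay (hG 2)
        (.mul_of_mem_symbols (mul_mem hτ hu) (hG 1))) (.mul_of_mem_symbols (mul_mem (mul_mem hhalf
          (pow_mem hε 2)) (pow_mem hu 2)) (hG 0))))
      (.mul_of_mem_symbols hA (.sub_rapidDecay (hG 1) (.mul_of_mem_symbols (mul_mem hα hu)
        (hG 0))))))
  have hYeq : ∀ᶠ ε in 𝓝[>] (0 : ℝ), ∀ k, Y ε k = d 1 ε k - u ε * d 0 ε k := by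
    filter_upwards [hD'le, hα0, h0, h1, hπ] with ε hle hαε e0 e1 e2 k
    have hne : D' ε k ≠ 0 := norm_pos_iff.1 (hmin.trans_le (hle k))
    have hαε' : (α ε : ℂ) ≠ 0 := by exact_mod_cast hαε
    specialize e0 k
    specialize e1 k
    specialize e2 k
    rcases eq_or_ne k 0 with rfl | hk
    · have hd0 : d 0 ε 0 = 0 := by simpa using e0
      have hd1 : d 1 ε 0 = 0 := by simpa [hαε'] using e1
      simp [Y, nonzeroMode, hd0, hd1]
    · simp only [Y, Pi.mul_apply, Pi.inv_apply]
      rw [inv_mul_eq_iff_eq_mul₀ hne]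
      simp only [A, G, s, derivSymbol, scalarSymbol, Pi.mul_apply, Pi.add_apply,
        Pi.one_apply] at e2
      simp only [D', D, A, G, s, derivSymbol, nonzeroMode, if_neg hk, Pi.mul_apply, Pi.add_apply,
        Pi.sub_apply, Pi.pow_apply, Pi.one_apply, one_mul, scalarSymbol, sub_self, add_zero]
      linear_combination (-(1 + Complex.I * k * Δt * u ε)) * (e1 - α ε * u ε * e0) +
        Complex.I * k * Δt * β ε * e2
  have hd0 : HasExpansion rapidDecay (d 0) := by
    refine HasExpansion.congr hcl (.mul_of_mem_symbols hAinv (.sub_rapidDecay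
      (.mul_of_mem_symbols (neg_mem hsm) hY) (hG 0))) ?_
    filter_upwards [hYeq, h0] with ε hy e0
    funext k
    simp only [Pi.mul_apply, Pi.inv_apply, Pi.sub_apply, Pi.neg_apply, hy]
    rw [inv_mul_eq_iff_eq_mul₀ (hA0 ε k)]
    simp only [A, G, s, derivSymbol, scalarSymbol, Pi.add_apply, Pi.mul_apply, Pi.one_apply]
    linear_combination -e0 k
  have hd1 : HasExpansion rapidDecay (d 1) := by
    refine HasExpansion.congr hcl (hY.add (.mul_of_mem_symbols hu hd0)) ?_
    filter_upwards [hYeq] with ε hy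
    funext k
    simp only [Pi.mul_apply, Pi.add_apply, hy, scalarSymbol]
    ring
  let K : ℝ → ℤ → ℂ := (fun _ _ => 2⁻¹) * scalarSymbol (fun ε => ε) ^ 2
  have hK : K ∈ symbols := mul_mem hhalf (pow_mem hε 2)
  have hd2 : HasExpansion rapidDecay (d 2) := by
    refine HasExpansion.congr hcl (.add (.mul_of_mem_symbols hAinv (.sub_rapidDecay
      (.mul_of_mem_symbols (neg_mem (mul_mem hsm hη)) hY) (.add (.sub_rapidDecay (hG 2)
        (.mul_of_mem_symbols (mul_mem hτ hu) (hG 1))) (.mul_of_mem_symbols (mul_mem hK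
          (pow_mem hu 2)) (hG 0))))) (.mul_of_mem_symbols (mul_mem hK hu) (hY.add hd1))) ?_
    filter_upwards [hYeq, hπ] with ε hy e
    funext k
    have hne := hA0 ε k
    simp only [Pi.mul_apply, Pi.inv_apply, Pi.sub_apply, Pi.neg_apply, Pi.add_apply,
      Pi.pow_apply, hy, K, scalarSymbol]
    rw [← eq_sub_iff_add_eq, inv_mul_eq_iff_eq_mul₀ hne]
    linear_combination -e k
  fin_cases i
  exacts [hd0, hd1, hd2]

end Solve

/-! ### The increment of one step -/

section Main

/-- Smooth periodic functions with expansions in `ε`. -/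
def smoothExpansions : Subring (ℝ → ℝ → ℝ) := isBoundedAlgebra_smoothBounded.expansions

theorem const_mem_smoothExpansions (r : ℝ) : (fun _ _ => r) ∈ smoothExpansions :=
  isBoundedAlgebra_smoothBounded.const_mem_expansions
    ⟨fun q => HasBoundedDerivs.const q r, Eventually.of_forall fun _ _ => rfl⟩

theorem param_mem_smoothExpansions : (fun ε _ => ε) ∈ smoothExpansions :=
  isBoundedAlgebra_smoothBounded.param_mem_expansions

theorem scalarSymbol_mem_symbols {r : ℝ → ℝ} (h : (fun ε _ => r ε) ∈ smoothExpansions) :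
    scalarSymbol r ∈ symbols := HasExpansion.eval_zero h

theorem exists_eventually_norm_le {r : ℝ → ℝ} (h : (fun ε _ => r ε) ∈ smoothExpansions) :
    ∃ C : ℝ, ∀ᶠ ε in 𝓝[>] (0 : ℝ), ‖r ε‖ ≤ C :=
  isBoundedAlgebra_smoothBounded.pointwise (h 0) 0

/-- For `γ > 1` the determinant is a perturbation, of relative size `ε²` uniformly in `k ≠ 0`, of
the positive number `(k Δt)² (γ - 1) η`. -/
theorem exists_le_norm_acoustic_factor {Δt g : ℝ} (hΔt : 0 < Δt) (hg : 0 < g) {u η : ℝ → ℝ}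
    {U η₀ : ℝ} (hη₀ : 0 < η₀) (hu : ∀ᶠ ε in 𝓝[>] (0 : ℝ), ‖u ε‖ ≤ U)
    (hη : ∀ᶠ ε in 𝓝[>] (0 : ℝ), η₀ ≤ η ε) :
    ∃ c > 0, ∀ᶠ ε in 𝓝[>] (0 : ℝ), ∀ k : ℤ, k ≠ 0 →
      c ≤ ‖((ε ^ 2 : ℝ) : ℂ) * (1 + Complex.I * k * Δt * u ε) ^ 2 -
        (Complex.I * k * Δt) ^ 2 * (g : ℂ) * η ε‖ := by
  refine ⟨Δt ^ 2 * (g * η₀ / 2), by positivity, ?_⟩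
  have hsmall : ∀ᶠ ε in 𝓝[>] (0 : ℝ), ε ^ 2 * (1 / Δt ^ 2 + U ^ 2) < g * η₀ / 2 := by
    have hc : Continuous fun ε : ℝ => ε ^ 2 * (1 / Δt ^ 2 + U ^ 2) := by fun_prop
    have := hc.tendsto 0
    simp only [ne_eq, OfNat.ofNat_ne_zero, not_false_eq_true, zero_pow, zero_mul] at this
    exact nhdsWithin_le_nhds (this.eventually (gt_mem_nhds (by positivity)))
  filter_upwards [hu, hη, hsmall] with ε huε hηε hsm k hk
  set κ : ℝ := k * Δt with hκ
  have hκ2 : Δt ^ 2 ≤ κ ^ 2 := by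
    have : (1 : ℝ) ≤ (k : ℝ) ^ 2 := by
      have : (1 : ℤ) ≤ k ^ 2 := by have := sq_pos_of_ne_zero hk; omega
      exact_mod_cast this
    rw [hκ, mul_pow]
    nlinarith [sq_nonneg Δt]
  have hU : u ε ^ 2 ≤ U ^ 2 := by
    rw [← sq_abs (u ε)]
    exact pow_le_pow_left₀ (abs_nonneg _) huε 2
  have hnorm : ‖(1 + Complex.I * k * Δt * u ε) ^ 2‖ = 1 + κ ^ 2 * u ε ^ 2 := by
    rw [norm_pow, Complex.sq_norm, Complex.normSq_apply]
    simp [hκ]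
    ring
  have e : ((ε ^ 2 : ℝ) : ℂ) * (1 + Complex.I * k * Δt * u ε) ^ 2 -
      (Complex.I * k * Δt) ^ 2 * (g : ℂ) * η ε =
      ((κ ^ 2 * g * η ε : ℝ) : ℂ) + ((ε ^ 2 : ℝ) : ℂ) * (1 + Complex.I * k * Δt * u ε) ^ 2 := by
    push_cast [hκ]
    linear_combination (-((k : ℂ) * Δt) ^ 2 * g * η ε) * Complex.I_sq
  have hη0 : 0 ≤ η ε := hη₀.le.trans hηε
  rw [e]
  refine le_trans ?_ (norm_sub_le_norm_add _ _)
  rw [norm_mul, Complex.norm_real, Complex.norm_real, hnorm, Real.norm_of_nonneg (by positivity),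
    Real.norm_of_nonneg (by positivity)]
  have h1 : 1 ≤ κ ^ 2 * (1 / Δt ^ 2) := by
    rw [mul_one_div, le_div_iff₀ (by positivity), one_mul]; exact hκ2
  calc Δt ^ 2 * (g * η₀ / 2) ≤ κ ^ 2 * (g * η₀ / 2) := by gcongr
    _ ≤ κ ^ 2 * (g * η₀ - ε ^ 2 * (1 / Δt ^ 2 + U ^ 2)) := by gcongr; linarith
    _ = κ ^ 2 * g * η₀ - ε ^ 2 * (κ ^ 2 * (1 / Δt ^ 2) + κ ^ 2 * U ^ 2) := by ring
    _ ≤ κ ^ 2 * g * η ε - ε ^ 2 * (1 + κ ^ 2 * u ε ^ 2) := by gcongr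

theorem one_le_norm_transport_factor_sq {Δt : ℝ} (u : ℝ → ℝ) (ε : ℝ) (k : ℤ) :
    1 ≤ ‖(1 + Complex.I * k * Δt * u ε) ^ 2‖ := by
  rw [norm_pow]
  exact one_le_pow₀ (one_le_norm_one_add_derivSymbol_mul Δt u ε k)

variable {γ Δt ε₀ : ℝ} {wR : ℝ → EulerState} {w0 w1 : ℝ → ℝ → EulerState}

/-- The increment of one step has an expansion, provided that a weight `α` of the momentum equation
makes its coefficients regular and the determinant invertible. -/
theorem hasExpansion_fourierHat_increment (hΔt : 0 < Δt) (hε₀ : 0 < ε₀)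
    (hwR : ∀ i, (fun ε _ => wR ε i) ∈ smoothExpansions)
    {c : ℝ} (hc : 0 < c) (hwR_pos : ∀ ε ∈ Set.Ioc 0 ε₀, c ≤ wR ε 0)
    (hw0 : ∀ ε ∈ Set.Ioc 0 ε₀, StateHInfty (w0 ε))
    (hw1 : ∀ ε ∈ Set.Ioc 0 ε₀, StateHInfty (w1 ε))
    {c' : ℝ} (hc' : 0 < c') (hw0_pos : ∀ ε ∈ Set.Ioc 0 ε₀, ∀ x, c' ≤ w0 ε x 0)
    (hw0_exp : ∀ i, (fun ε x => w0 ε x i) ∈ smoothExpansions)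
    (hstep : ∀ ε ∈ Set.Ioc 0 ε₀, IsLinearlyImplicitStep γ ε Δt (wR ε) (w0 ε) (w1 ε))
    {α β τ : ℝ → ℝ} (hα : (fun ε _ => α ε) ∈ smoothExpansions)
    (hβ : (fun ε _ => β ε) ∈ smoothExpansions) (hτ : (fun ε _ => τ ε) ∈ smoothExpansions)
    (hτα : ∀ ε, τ ε * α ε = ε ^ 2) (hτβ : ∀ ε, τ ε * β ε = γ - 1)
    (hdet : ∃ c > 0, ∀ᶠ ε in 𝓝[>] (0 : ℝ), ∀ k : ℤ, k ≠ 0 →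
      c ≤ ‖(α ε : ℂ) * (1 + Complex.I * k * Δt * (wR ε 1 / wR ε 0 : ℝ)) ^ 2 -
        (Complex.I * k * Δt) ^ 2 * β ε * (γ * internalEnergy ε (wR ε) / wR ε 0 : ℝ)‖)
    (i : Fin 3) :
    HasExpansion rapidDecay (fun ε => fourierHat fun x => w1 ε x i - w0 ε x i) := by
  have hmem : ∀ᶠ ε in 𝓝[>] (0 : ℝ), ε ∈ Set.Ioc 0 ε₀ := Ioc_mem_nhdsGT hε₀
  have hlow : ∀ {c : ℝ} {v : ℝ → ℝ → ℝ}, 0 < c → (∀ ε ∈ Set.Ioc 0 ε₀, ∀ x, c ≤ v ε x) →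
      v ∈ smoothExpansions → v⁻¹ ∈ smoothExpansions := fun hc hv h =>
    isBoundedAlgebra_smoothBounded.inv_mem_expansions hc (hmem.mono fun ε hε x =>
      (hv ε hε x).trans (le_abs_self _)) h
  have hK : (fun ε _ => ε ^ 2 / 2) ∈ smoothExpansions :=
    mul_mem (pow_mem param_mem_smoothExpansions 2) (const_mem_smoothExpansions 2⁻¹)
  have henergy : ∀ v : ℝ → ℝ → EulerState, (∀ i, (fun ε x => v ε x i) ∈ smoothExpansions) →
      (fun ε x => v ε x 0)⁻¹ ∈ smoothExpansions →
      (fun ε x => internalEnergy ε (v ε x)) ∈ smoothExpansions := fun v hv hi =>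
    sub_mem (hv 2) (mul_mem hK (mul_mem (pow_mem (hv 1) 2) hi))
  have hRi := hlow hc (v := fun ε _ => wR ε 0) (fun ε hε _ => hwR_pos ε hε) (hwR 0)
  have h0i := hlow hc' hw0_pos (hw0_exp 0)
  have hRe := henergy (fun ε _ => wR ε) hwR hRi
  have h0e := henergy w0 hw0_exp h0i
  have hu : (fun ε _ => wR ε 1 / wR ε 0) ∈ smoothExpansions := mul_mem (hwR 1) hRi
  have hη : (fun ε _ => γ * internalEnergy ε (wR ε) / wR ε 0) ∈ smoothExpansions :=
    mul_mem (mul_mem (const_mem_smoothExpansions γ) hRe) hRi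
  have hq : (fun ε x => w0 ε x 1 ^ 2 / w0 ε x 0) ∈ smoothExpansions :=
    mul_mem (pow_mem (hw0_exp 1) 2) h0i
  have hp : (fun ε x => pressure γ ε (w0 ε x)) ∈ smoothExpansions :=
    mul_mem (const_mem_smoothExpansions (γ - 1)) h0e
  let Φ : Fin 3 → ℝ → ℝ → ℝ := ![fun ε x => w0 ε x 1,
    fun ε x => α ε * (w0 ε x 1 ^ 2 / w0 ε x 0) + β ε * internalEnergy ε (w0 ε x),
    fun ε x => w0 ε x 1 / w0 ε x 0 * (w0 ε x 2 + pressure γ ε (w0 ε x))]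
  have hΦ : ∀ i, Φ i ∈ smoothExpansions := by
    intro i
    fin_cases i
    · exact hw0_exp 1
    · exact add_mem (mul_mem hα hq) (mul_mem hβ h0e)
    · exact mul_mem (mul_mem (hw0_exp 1) h0i) (add_mem (hw0_exp 2) hp)
  have heq : ∀ᶠ ε in 𝓝[>] (0 : ℝ), ∀ i k,
      fourierHat (fun x => w1 ε x i - w0 ε x i) k + Complex.I * k * Δt *
      (fourierHat (fun x => eulerFlux γ ε (w0 ε x) i) k +
        ∑ j, (fderiv ℝ (eulerFlux γ ε) (wR ε) (Pi.single j 1) i : ℂ) *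
          fourierHat (fun x => w1 ε x j - w0 ε x j) k) = 0 :=
    hmem.mono fun ε hε i k => (hstep ε hε).fourierHat_eq hΔt.ne' (hw0 ε hε) (hw1 ε hε)
      (fun x => (hc'.trans_le (hw0_pos ε hε x)).ne') i k
  have hne : ∀ᶠ ε in 𝓝[>] (0 : ℝ), wR ε 0 ≠ 0 :=
    hmem.mono fun ε hε => (hc.trans_le (hwR_pos ε hε)).ne'
  refine hasExpansion_of_linearized_step
    (d := fun i ε => fourierHat fun x => w1 ε x i - w0 ε x i) (g := fun _ => γ - 1)
    (H := fun i ε => fourierHat (Φ i ε)) (scalarSymbol_mem_symbols hα)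
    (scalarSymbol_mem_symbols hβ) (scalarSymbol_mem_symbols hτ) (scalarSymbol_mem_symbols hu)
    (scalarSymbol_mem_symbols hη) hτα hτβ ?_ hdet (fun i => (hΦ i).fourierHat) ?_ ?_ ?_ i
  · filter_upwards [hmem] with ε hε h
    have := hτα ε
    rw [h, mul_zero] at this
    exact (pow_pos hε.1 2).ne this
  · filter_upwards [heq, hne] with ε h hne k
    have := h 0 k
    simp only [Fin.sum_univ_three, fderiv_eulerFlux_apply γ ε hne] at this
    simp [eulerFlux] at this
    exact this
  · filter_upwards [heq, hne, hmem] with ε h hne hε k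
    have hε0 : ε ≠ 0 := hε.1.ne'
    have hg : α ε * ((γ - 1) / ε ^ 2) = β ε := by
      rw [← hτβ, ← hτα ε]
      have : τ ε * α ε ≠ 0 := by rw [hτα]; positivity
      have h1 := left_ne_zero_of_mul this
      have h2 := right_ne_zero_of_mul this
      field_simp
    have hgC : (α ε : ℂ) * ((γ - 1) / ε ^ 2) = β ε := by exact_mod_cast hg
    have hH : fourierHat (Φ 1 ε) k = α ε * fourierHat (fun x => eulerFlux γ ε (w0 ε x) 1) k := by
      have : Φ 1 ε = α ε • fun x => eulerFlux γ ε (w0 ε x) 1 := by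
        funext x
        simp only [Φ, eulerFlux, pressure, Matrix.cons_val_one, Matrix.cons_val_zero,
          Pi.smul_apply, smul_eq_mul, ← hg]
        ring
      rw [this, fourierHat_smul, Pi.smul_apply, Complex.real_smul]
    have := h 1 k
    simp only [Fin.sum_univ_three, fderiv_eulerFlux_apply γ ε hne] at this
    simp only [hH]
    set f := fourierHat (fun x => eulerFlux γ ε (w0 ε x) 1) k
    simp at this ⊢
    rw [← hgC]
    linear_combination (α ε : ℂ) * this
  · filter_upwards [heq, hne] with ε h hne k
    have := h 2 k
    have hh : (wR ε 2 + pressure γ ε (wR ε)) / wR ε 0 = γ * internalEnergy ε (wR ε) / wR ε 0 +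
        ε ^ 2 / 2 * (wR ε 1 / wR ε 0) ^ 2 := by
      rw [pressure, internalEnergy]
      field_simp
      ring
    simp only [Fin.sum_univ_three, fderiv_eulerFlux_apply γ ε hne, hh] at this
    change _ + _ * (fourierHat (fun x => eulerFlux γ ε (w0 ε x) 2) k + _) = 0
    set f := fourierHat (fun x => eulerFlux γ ε (w0 ε x) 2) k
    simp at this ⊢
    linear_combination this

end Main

end

theorem mainTheorem4 (γ Δt ε₀ : ℝ) (hγ : 1 ≤ γ) (hΔt : 0 < Δt) (hε₀ : 0 < ε₀)
    -- reference state, constant in space, in the physical range uniformly in `ε`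
    (wR : ℝ → EulerState)
    (hwR : HasHilbertExpansion (fun ε _ => wR ε))
    (hwR_pos : ∃ c > 0, ∀ ε ∈ Set.Ioc 0 ε₀, c ≤ wR ε 0 ∧ c ≤ internalEnergy ε (wR ε))
    -- old and new time level
    (w0 w1 : ℝ → ℝ → EulerState)
    (hw0 : ∀ ε ∈ Set.Ioc 0 ε₀, StateHInfty (w0 ε))
    (hw1 : ∀ ε ∈ Set.Ioc 0 ε₀, StateHInfty (w1 ε))
    (hw0_pos : ∃ c > 0, ∀ ε ∈ Set.Ioc 0 ε₀, ∀ x, c ≤ w0 ε x 0)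
    (hw0_exp : HasHilbertExpansion (fun ε x => w0 ε x - wR ε))
    (hstep : ∀ ε ∈ Set.Ioc 0 ε₀, IsLinearlyImplicitStep γ ε Δt (wR ε) (w0 ε) (w1 ε)) :
    HasHilbertExpansion (fun ε x => w1 ε x - wR ε) := by
  have hmem : ∀ᶠ ε in 𝓝[>] (0 : ℝ), ε ∈ Set.Ioc 0 ε₀ := Ioc_mem_nhdsGT hε₀
  obtain ⟨c, hc, hR⟩ := hwR_pos
  obtain ⟨c', hc', hw0_pos⟩ := hw0_pos
  have hRexp : ∀ i, (fun ε _ => wR ε i) ∈ smoothExpansions := hwR.hasExpansion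
  have h0exp : ∀ i, (fun ε x => w0 ε x i) ∈ smoothExpansions := fun i => by
    convert smoothExpansions.add_mem (hw0_exp.hasExpansion i) (hRexp i) using 1
    funext ε x
    simp
  have hincr : ∀ i, HasExpansion rapidDecay
      (fun ε => fourierHat fun x => w1 ε x i - w0 ε x i) := by
    intro i
    rcases hγ.eq_or_lt with hγ1 | hγ1
    -- For `γ = 1` the pressure vanishes, the flux is regular in `ε`, and no weight is needed.
    · refine hasExpansion_fourierHat_increment hΔt hε₀ hRexp hc (fun ε hε => (hR ε hε).1) hw0 hw1
        hc' hw0_pos h0exp hstep (α := fun _ => 1) (β := fun _ => 0) (τ := fun ε => ε ^ 2)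
        (const_mem_smoothExpansions 1) (const_mem_smoothExpansions 0)
        (pow_mem param_mem_smoothExpansions 2) (by simp) (by simp [← hγ1])
        ⟨1, one_pos, Eventually.of_forall fun ε k _ => ?_⟩ i
      simpa using one_le_norm_transport_factor_sq (Δt := Δt) (fun ε => wR ε 1 / wR ε 0) ε k
    -- For `γ > 1` the momentum equation is multiplied by `ε²`.
    · have hRi : (fun (ε : ℝ) (_ : ℝ) => wR ε 0)⁻¹ ∈ smoothExpansions :=
        isBoundedAlgebra_smoothBounded.inv_mem_expansions hc (hmem.mono fun ε hε x =>
          (hR ε hε).1.trans (le_abs_self _)) (hRexp 0)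
      obtain ⟨R, hRle⟩ := exists_eventually_norm_le (hRexp 0)
      obtain ⟨U, hU⟩ := exists_eventually_norm_le (r := fun ε => wR ε 1 / wR ε 0)
        (mul_mem (hRexp 1) hRi)
      have hR0 : 0 < R := by
        obtain ⟨ε, h1, h2⟩ := (hRle.and hmem).exists
        exact hc.trans_le ((hR ε h2).1.trans ((le_abs_self _).trans h1))
      refine hasExpansion_fourierHat_increment hΔt hε₀ hRexp hc (fun ε hε => (hR ε hε).1) hw0 hw1
        hc' hw0_pos h0exp hstep (α := fun ε => ε ^ 2) (β := fun _ => γ - 1) (τ := fun _ => 1)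
        (pow_mem param_mem_smoothExpansions 2) (const_mem_smoothExpansions (γ - 1))
        (const_mem_smoothExpansions 1) (by simp) (by simp)
        (exists_le_norm_acoustic_factor (u := fun ε => wR ε 1 / wR ε 0)
          (η := fun ε => γ * internalEnergy ε (wR ε) / wR ε 0) hΔt (sub_pos.2 hγ1)
          (div_pos hc hR0) hU ?_) i
      filter_upwards [hRle, hmem] with ε h1 h2
      obtain ⟨h3, h4⟩ := hR ε h2
      have h5 : wR ε 0 ≤ R := (le_abs_self _).trans h1
      have h6 : 0 < wR ε 0 := hc.trans_le h3
      have h7 : c ≤ γ * internalEnergy ε (wR ε) := by nlinarith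
      exact div_le_div₀ (hc.le.trans h7) h7 h6 h5
  refine hasHilbertExpansion_of_hasExpansion ?_ fun i => ?_
  · filter_upwards [hmem, hw0_exp.1] with ε h1 h2 i
    convert (h2 i).add ((hw1 ε h1 i).sub (hw0 ε h1 i)) using 1
    funext x
    simp
  · refine ((hw0_exp.hasExpansion i).add (hincr i).fourierSynth).congr
      isBoundedAlgebra_smoothBounded.toIsBoundedClass ?_
    filter_upwards [hmem, eventually_summable_of_mem_rapidDecay (hincr i 0)] with ε h1 h2
    have hd := (hw1 ε h1 i).sub (hw0 ε h1 i)
    have := fourierSynth_fourierHat hd.continuous hd.periodic h2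
    funext x
    have hx := congrFun this x
    simp only [Pi.sub_apply] at hx
    change (w0 ε x - wR ε) i + fourierSynth (fourierHat ((fun x => w1 ε x i) - fun x => w0 ε x i)) x
      = (w1 ε x - wR ε) i
    rw [hx]
    simp
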